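/- Let $\mathscr S(\mathbb R^n)$ be the Schwartz space of complex-valued functions and $\mathscr S'(\mathbb R^n)$ its dual (the tempered distributions) with the weak-$*$ topology. Let $\mathscr F$ be the Fourier transform, $\mathscr F\varphi(\xi)=\int_{\mathbb R^n}e^{-ix\cdot\xi}\varphi(x)\,dx$ on $\mathscr S(\mathbb R^n)$, extended to $\mathscr S'(\mathbb R^n)$ by duality. Put $\langle\xi\rangle=(1+|\xi|^2)^{1/2}$ and $n^+=[n/2]+1$. Let $\mathcal K$ be the class of measurable functions $\chi:\mathbb R^n\to(0,\infty)$ for which there are constants $C,\ell>0$ with $\chi(\xi+\eta)\le C(1+|\xi|)^{\ell}\chi(\eta)$ for all $\xi,\eta\in\mathbb R^n$. Let $\mathcal K_1$ be the class of those $\chi\in\mathcal K\cap C^{2n^+}(\mathbb R^n)$ for which there are constants $C_\chi,\ell_\chi>0$ with $$|D^\alpha\chi(\xi)|\le C_\chi\langle\xi\rangle^{\ell_\chi}\qquad(\xi\in\mathbb R^n,\ |\alpha|\le 2n^+).\tag{$*$}$$ Let $\mathcal K_0$ be the class of those $\chi\in\mathcal K\cap C^\infty(\mathbb R^n)$ for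 which $\chi^{-1}\in\mathcal K$, $\chi\varphi\in\mathscr S(\mathbb R^n)$ for all $\varphi\in\mathscr S(\mathbb R^n)$, and $(*)$ holds for some $C_\chi,\ell_\chi>0$. Let $1<p<\infty$, and let $\chi\in\mathcal K_1$ if $p\le 2$ and $\chi\in\mathcal K_0$ if $p>2$. If $p\le2$, let $H^\chi_p(\mathbb R^n)$ be the set of all $u\in\mathscr S'(\mathbb R^n)$ such that $\mathscr Fu$ is a measurable function, the function $\chi\mathscr Fu$ is a tempered distribution, and $\mathscr F^{-1}\chi\mathscr Fu\in L_p(\mathbb R^n)$. (Here a tempered distribution $T$ is a measurable function $f$ if, for every $\varphi\in\mathscr S(\mathbb R^n)$, $f\varphi$ is integrable and $T(\varphi)=\int f\varphi\,dx$.) If $p>2$, let $H^\chi_p(\mathbb R^n)$ be the set of all $u\in\mathscr S'(\mathbb R^n)$ such that $\mathscr F^{-1}\chi\mathscr Fu\in L_p(\mathbb R^n)$, where $(\chi T)(\varphi)=T(\chi\varphi)$ for $T\in\mathscr S'(\mathbb R^n)$ and $\varphi\in\mathscr S(\mathbb R^n)$. In both cases $H^\chi_p(\mathbb R^n)$ is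 equipped with the norm $\|u\|=\|\mathscr F^{-1}\chi\mathscr Fu\|_{L_p(\mathbb R^n)}$. **Proposition.** $\mathscr S(\mathbb R^n)\subset H^\chi_p(\mathbb R^n)\subset\mathscr S'(\mathbb R^n)$, where $\varphi\in\mathscr S(\mathbb R^n)$ is identified with the distribution $\psi\mapsto\int\varphi\psi\,dx$, and both inclusions are continuous. Moreover, $\mathscr S(\mathbb R^n)$ is dense in $H^\chi_p(\mathbb R^n)$. -/

import Mathlib

open MeasureTheory FourierTransform
open scoped SchwartzMap ENNReal ContDiff

noncomputable section

namespace GenSobolev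

/-- `ℝⁿ` with its Euclidean norm. -/
abbrev Rn (n : ℕ) : Type := EuclideanSpace ℝ (Fin n)

variable {n : ℕ}

/-! ### The Fourier transform with kernel `exp (-i x·ξ)` -/

/-- The dilation `x ↦ c x` of `ℝⁿ`, for `c ≠ 0`. -/
def dilation (n : ℕ) (c : ℝ) (hc : c ≠ 0) : Rn n ≃L[ℝ] Rn n :=
  ContinuousLinearEquiv.smulLeft (Units.mk0 c hc)

theorem two_pi_ne_zero : (2 * Real.pi : ℝ) ≠ 0 := by positivity

/-- The Fourier transform `(F φ)(ξ) = ∫ exp (-i x·ξ) φ(x) dx` on the Schwartz space. Mathlib's `𝓕`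
has the kernel `exp (-2 π i x·ξ)`, so `(F φ)(ξ) = (𝓕 φ)(ξ / 2π)`. -/
def fourierS (n : ℕ) : 𝓢(Rn n, ℂ) →L[ℂ] 𝓢(Rn n, ℂ) :=
  (SchwartzMap.compCLMOfContinuousLinearEquiv ℂ
    (dilation n (2 * Real.pi)⁻¹ (inv_ne_zero two_pi_ne_zero))) ∘L (fourierCLM ℂ 𝓢(Rn n, ℂ))

/-- The inverse of `fourierS`. -/
def fourierInvS (n : ℕ) : 𝓢(Rn n, ℂ) →L[ℂ] 𝓢(Rn n, ℂ) :=
  (fourierInvCLM ℂ 𝓢(Rn n, ℂ)) ∘L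
    (SchwartzMap.compCLMOfContinuousLinearEquiv ℂ (dilation n (2 * Real.pi) two_pi_ne_zero))

theorem fourierS_apply (φ : 𝓢(Rn n, ℂ)) (ξ : Rn n) :
    fourierS n φ ξ = ∫ x, Complex.exp (-(Complex.I * (inner ℝ x ξ : ℝ))) * φ x := by
  have h : fourierS n φ ξ = (𝓕 φ : 𝓢(Rn n, ℂ)) ((2 * Real.pi)⁻¹ • ξ) := rfl
  rw [h, SchwartzMap.fourier_coe, Real.fourier_eq']
  congr 1
  ext x
  rw [smul_eq_mul, inner_smul_right]
  congr 2
  have : (Real.pi : ℂ) ≠ 0 := by exact_mod_cast Real.pi_ne_zero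
  push_cast
  field_simp

theorem fourierInvS_fourierS (φ : 𝓢(Rn n, ℂ)) : fourierInvS n (fourierS n φ) = φ := by
  have h : SchwartzMap.compCLMOfContinuousLinearEquiv ℂ (dilation n (2 * Real.pi) two_pi_ne_zero)
      (fourierS n φ) = (𝓕 φ : 𝓢(Rn n, ℂ)) := by
    ext ξ
    change (𝓕 φ : 𝓢(Rn n, ℂ)) ((2 * Real.pi)⁻¹ • ((2 * Real.pi) • ξ)) = _
    rw [smul_smul, inv_mul_cancel₀ two_pi_ne_zero, one_smul]
  change 𝓕⁻ (SchwartzMap.compCLMOfContinuousLinearEquiv ℂ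
    (dilation n (2 * Real.pi) two_pi_ne_zero) (fourierS n φ)) = φ
  rw [h, fourierInv_fourier_eq]

theorem fourierS_fourierInvS (φ : 𝓢(Rn n, ℂ)) : fourierS n (fourierInvS n φ) = φ := by
  have h : (𝓕 (fourierInvS n φ) : 𝓢(Rn n, ℂ)) = SchwartzMap.compCLMOfContinuousLinearEquiv ℂ
      (dilation n (2 * Real.pi) two_pi_ne_zero) φ := fourier_fourierInv_eq _
  ext ξ
  change (𝓕 (fourierInvS n φ) : 𝓢(Rn n, ℂ)) ((2 * Real.pi)⁻¹ • ξ) = φ ξ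
  rw [h]
  change φ ((2 * Real.pi) • ((2 * Real.pi)⁻¹ • ξ)) = φ ξ
  rw [smul_smul, mul_inv_cancel₀ two_pi_ne_zero, one_smul]

/-- The Fourier transform on tempered distributions, `(F u)(φ) = u(F φ)`. Here `𝓢'(Rn n, ℂ)` is
the space of continuous linear functionals on `𝓢(Rn n, ℂ)` with the weak-* topology. -/
def fourierD (n : ℕ) : 𝓢'(Rn n, ℂ) →L[ℂ] 𝓢'(Rn n, ℂ) :=
  PointwiseConvergenceCLM.precomp ℂ (fourierS n)

/-- The inverse Fourier transform on tempered distributions, `(F⁻¹ u)(φ) = u(F⁻¹ φ)`. -/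
def fourierInvD (n : ℕ) : 𝓢'(Rn n, ℂ) →L[ℂ] 𝓢'(Rn n, ℂ) :=
  PointwiseConvergenceCLM.precomp ℂ (fourierInvS n)

@[simp]
theorem fourierD_apply (u : 𝓢'(Rn n, ℂ)) (φ : 𝓢(Rn n, ℂ)) :
    fourierD n u φ = u (fourierS n φ) := rfl

@[simp]
theorem fourierInvD_apply (u : 𝓢'(Rn n, ℂ)) (φ : 𝓢(Rn n, ℂ)) :
    fourierInvD n u φ = u (fourierInvS n φ) := rfl

/-! ### Weight functions -/

/-- The class `𝒦` of weight functions. -/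
structure MemK (χ : Rn n → ℝ) : Prop where
  measurable : Measurable χ
  pos : ∀ ξ, 0 < χ ξ
  exists_bound : ∃ C > 0, ∃ l : ℝ, 0 < l ∧
    ∀ ξ η, χ (ξ + η) ≤ C * (1 + ‖ξ‖) ^ l * χ η

/-- `t⁺ = [t/2] + 1`. -/
def plus (t : ℕ) : ℕ := t / 2 + 1

/-- The derivatives of `χ` up to order `2n⁺` are bounded by `C ⟨ξ⟩ ^ l`, where
`⟨ξ⟩ = (1 + |ξ|²) ^ (1/2)`. -/
def DerivBound (χ : Rn n → ℝ) : Prop :=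
  ∃ C > 0, ∃ l : ℝ, 0 < l ∧ ∀ k ≤ 2 * plus n, ∀ ξ,
    ‖iteratedFDeriv ℝ k χ ξ‖ ≤ C * (Real.sqrt (1 + ‖ξ‖ ^ 2)) ^ l

/-- The class `𝒦₁`: members of `𝒦` of class `C^{2n⁺}` whose derivatives up to that order have
polynomial growth. -/
structure MemK₁ (χ : Rn n → ℝ) : Prop extends MemK χ where
  contDiff : ContDiff ℝ (2 * plus n : ℕ) χ
  derivBound : DerivBound χ

/-- `χ` is a multiplier on the Schwartz space: multiplication by `χ` maps `𝓢(Rn n, ℂ)` into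
itself. -/
def IsSchwartzMultiplier (χ : Rn n → ℝ) : Prop :=
  ∀ φ : 𝓢(Rn n, ℂ), ∃ ψ : 𝓢(Rn n, ℂ), ∀ ξ, ψ ξ = (χ ξ : ℂ) * φ ξ

/-- The class `𝒦₀`: smooth members of `𝒦` which are multipliers on the Schwartz space and whose
inverses belong to `𝒦`; the derivatives up to order `2n⁺` have polynomial growth. -/
structure MemK₀ (χ : Rn n → ℝ) : Prop extends MemK χ where
  contDiff : ContDiff ℝ ∞ χ
  multiplier : IsSchwartzMultiplier χ
  inv_mem : MemK (fun ξ => (χ ξ)⁻¹)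
  derivBound : DerivBound χ

/-- The standing assumption on the weight: `χ ∈ 𝒦₁` if `p ≤ 2`, and `χ ∈ 𝒦₀` if `p > 2`. -/
def Admissible (p : ℝ≥0∞) (χ : Rn n → ℝ) : Prop :=
  (p ≤ 2 → MemK₁ χ) ∧ (2 < p → MemK₀ χ)

/-! ### The product of a weight and a tempered distribution -/

/-- The tempered distribution `T` is the measurable function `f`. -/
def IsFunction (T : 𝓢'(Rn n, ℂ)) (f : Rn n → ℂ) : Prop :=
  Measurable f ∧ ∀ φ : 𝓢(Rn n, ℂ),
    Integrable (fun x => f x * φ x) ∧ T φ = ∫ x, f x * φ x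

/-- `χ T = S`, for a tempered distribution `T` which is a measurable function `f`: the function
`χ f` is the tempered distribution `S`. -/
def IsFunctionProduct (χ : Rn n → ℝ) (T S : 𝓢'(Rn n, ℂ)) : Prop :=
  ∃ f : Rn n → ℂ, IsFunction T f ∧ IsFunction S (fun x => (χ x : ℂ) * f x)

/-- `χ T = S` for a multiplier `χ` on the Schwartz space: `S(φ) = T(χ φ)`. -/
def IsMultiplierProduct (χ : Rn n → ℝ) (T S : 𝓢'(Rn n, ℂ)) : Prop :=
  ∀ φ ψ : 𝓢(Rn n, ℂ), (∀ ξ, ψ ξ = (χ ξ : ℂ) * φ ξ) → S φ = T ψ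

/-- `χ T = S`, in the sense used for the exponent `p`. -/
def IsProduct (p : ℝ≥0∞) (χ : Rn n → ℝ) (T S : 𝓢'(Rn n, ℂ)) : Prop :=
  (p ≤ 2 → IsFunctionProduct χ T S) ∧ (2 < p → IsMultiplierProduct χ T S)

/-- `F⁻¹ χ F u` exists and is the element `v` of `L_p`. -/
def IsImage (p : ℝ≥0∞) [Fact (1 ≤ p)] (χ : Rn n → ℝ) (u : 𝓢'(Rn n, ℂ))
    (v : Lp ℂ p (volume : Measure (Rn n))) : Prop :=
  ∃ S : 𝓢'(Rn n, ℂ), IsProduct p χ (fourierD n u) S ∧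
    fourierInvD n S = Lp.toTemperedDistribution v

section Facts

theorem IsFunction.add {T T' : 𝓢'(Rn n, ℂ)} {f f' : Rn n → ℂ} (h : IsFunction T f)
    (h' : IsFunction T' f') : IsFunction (T + T') (fun x => f x + f' x) := by
  refine ⟨h.1.add h'.1, fun φ => ?_⟩
  have e : (fun x => (f x + f' x) * φ x) = fun x => f x * φ x + f' x * φ x := by
    ext x; ring
  rw [e]
  refine ⟨(h.2 φ).1.add (h'.2 φ).1, ?_⟩
  rw [integral_add (h.2 φ).1 (h'.2 φ).1, ← (h.2 φ).2, ← (h'.2 φ).2]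
  rfl

theorem IsFunction.smul {T : 𝓢'(Rn n, ℂ)} {f : Rn n → ℂ} (c : ℂ) (h : IsFunction T f) :
    IsFunction (c • T) (fun x => c * f x) := by
  refine ⟨h.1.const_mul c, fun φ => ?_⟩
  have e : (fun x => c * f x * φ x) = fun x => c * (f x * φ x) := by
    ext x; ring
  rw [e]
  refine ⟨(h.2 φ).1.const_mul c, ?_⟩
  rw [integral_const_mul, ← (h.2 φ).2]
  rfl

theorem IsFunction.zero : IsFunction (0 : 𝓢'(Rn n, ℂ)) (fun _ => 0) :=
  ⟨measurable_const, fun φ => by simp⟩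

theorem IsFunction.ae_eq_zero {f : Rn n → ℂ} (h : IsFunction (0 : 𝓢'(Rn n, ℂ)) f) :
    ∀ᵐ x, f x = 0 := by
  have key : ∀ g : Rn n → ℝ, ContDiff ℝ ∞ g → HasCompactSupport g →
      ∃ φ : 𝓢(Rn n, ℂ), ∀ x, φ x = (g x : ℂ) := by
    intro g hg hc
    have hg₁ : HasCompactSupport (Complex.ofRealCLM ∘ g) := hc.comp_left rfl
    have hg₂ : ContDiff ℝ ∞ (Complex.ofRealCLM ∘ g) := by fun_prop
    exact ⟨hg₁.toSchwartzMap hg₂, fun x => rfl⟩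
  apply ae_eq_zero_of_integral_contDiff_smul_eq_zero
  · intro x
    let b : ContDiffBump x := ⟨1, 2, one_pos, one_lt_two⟩
    obtain ⟨φ, hφ⟩ := key b b.contDiff b.hasCompactSupport
    refine ⟨Metric.closedBall x 1, Metric.closedBall_mem_nhds x one_pos, ?_⟩
    refine ((h.2 φ).1.integrableOn (s := Metric.closedBall x 1)).congr_fun ?_
      Metric.isClosed_closedBall.measurableSet
    intro y hy
    have : b y = 1 := b.one_of_mem_closedBall hy
    simp [hφ, this]
  · intro g hg hc
    obtain ⟨φ, hφ⟩ := key g hg hc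
    have := (h.2 φ).2
    simp only [hφ] at this
    rw [show (fun x => g x • f x) = fun x => f x * (g x : ℂ) from by
      ext x; rw [Complex.real_smul, mul_comm], ← this]
    rfl

theorem IsFunction.eq_zero {T : 𝓢'(Rn n, ℂ)} {f : Rn n → ℂ} (h : IsFunction T f)
    (hf : ∀ᵐ x, f x = 0) : T = 0 := by
  ext φ
  rw [(h.2 φ).2, integral_eq_zero_of_ae]
  · rfl
  · filter_upwards [hf] with x hx
    simp [hx]

variable {p : ℝ≥0∞} {χ : Rn n → ℝ}

theorem IsProduct.add {T T' S S' : 𝓢'(Rn n, ℂ)} (h : IsProduct p χ T S)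
    (h' : IsProduct p χ T' S') : IsProduct p χ (T + T') (S + S') := by
  refine ⟨fun hp => ?_, fun hp φ ψ hψ => ?_⟩
  · obtain ⟨f, h₁, h₂⟩ := h.1 hp
    obtain ⟨f', h₁', h₂'⟩ := h'.1 hp
    exact ⟨_, h₁.add h₁', by simpa only [mul_add] using h₂.add h₂'⟩
  · change S φ + S' φ = T ψ + T' ψ
    rw [h.2 hp φ ψ hψ, h'.2 hp φ ψ hψ]

theorem IsProduct.smul {T S : 𝓢'(Rn n, ℂ)} (c : ℂ) (h : IsProduct p χ T S) :
    IsProduct p χ (c • T) (c • S) := by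
  refine ⟨fun hp => ?_, fun hp φ ψ hψ => ?_⟩
  · obtain ⟨f, h₁, h₂⟩ := h.1 hp
    exact ⟨_, h₁.smul c, by simpa only [mul_left_comm] using h₂.smul c⟩
  · change c • S φ = c • T ψ
    rw [h.2 hp φ ψ hψ]

theorem IsProduct.zero : IsProduct p χ (0 : 𝓢'(Rn n, ℂ)) 0 :=
  ⟨fun _ => ⟨_, IsFunction.zero, by simpa using IsFunction.zero⟩, fun _ _ _ _ => rfl⟩

theorem IsProduct.eq_zero {S : 𝓢'(Rn n, ℂ)} (hχ : Admissible p χ) (h : IsProduct p χ 0 S) :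
    S = 0 := by
  rcases le_or_gt p 2 with hp | hp
  · obtain ⟨f, h₁, h₂⟩ := h.1 hp
    refine h₂.eq_zero ?_
    filter_upwards [h₁.ae_eq_zero] with x hx
    simp [hx]
  · ext φ
    obtain ⟨ψ, hψ⟩ := (hχ.2 hp).multiplier φ
    exact h.2 hp φ ψ hψ

variable [Fact (1 ≤ p)] {u u' : 𝓢'(Rn n, ℂ)} {v v' : Lp ℂ p (volume : Measure (Rn n))}

theorem IsImage.add (h : IsImage p χ u v) (h' : IsImage p χ u' v') :
    IsImage p χ (u + u') (v + v') := by
  obtain ⟨S, h₁, h₂⟩ := h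
  obtain ⟨S', h₁', h₂'⟩ := h'
  refine ⟨S + S', by simpa only [map_add] using h₁.add h₁', ?_⟩
  rw [map_add, h₂, h₂']
  exact (map_add (Lp.toTemperedDistributionCLM ℂ volume p) v v').symm

theorem IsImage.smul (c : ℂ) (h : IsImage p χ u v) : IsImage p χ (c • u) (c • v) := by
  obtain ⟨S, h₁, h₂⟩ := h
  refine ⟨c • S, by simpa only [map_smul] using h₁.smul c, ?_⟩
  rw [map_smul, h₂]
  exact (map_smul (Lp.toTemperedDistributionCLM ℂ volume p) c v).symm

theorem IsImage.zero : IsImage p χ (0 : 𝓢'(Rn n, ℂ)) 0 :=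
  ⟨0, by simpa only [map_zero] using IsProduct.zero, by
    rw [map_zero]; exact (map_zero (Lp.toTemperedDistributionCLM ℂ volume p)).symm⟩

/-- `F⁻¹ χ F u` is uniquely determined by `u`. -/
theorem IsImage.unique (hχ : Admissible p χ) (h : IsImage p χ u v) (h' : IsImage p χ u v') :
    v = v' := by
  have hd := h.add (h'.smul (-1))
  have e : u + (-1 : ℂ) • u = 0 := by
    ext φ
    change u φ + (-1 : ℂ) • u φ = 0
    simp
  rw [e] at hd
  obtain ⟨S, h₁, h₂⟩ := hd
  rw [map_zero] at h₁
  rw [h₁.eq_zero hχ, map_zero] at h₂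
  have hk : v + (-1 : ℂ) • v' ∈ (Lp.toTemperedDistributionCLM ℂ (volume : Measure (Rn n)) p).ker :=
    h₂.symm
  rw [Lp.ker_toTemperedDistributionCLM_eq_bot] at hk
  have : v + (-1 : ℂ) • v' = 0 := hk
  simpa [← sub_eq_add_neg, sub_eq_zero] using this

end Facts

/-! ### The space `H^χ_p(ℝⁿ)` -/

/-- The linear space `H^χ_p(ℝⁿ)` of all tempered distributions `u` with `F⁻¹ χ F u ∈ L_p(ℝⁿ)`.
If `p ≤ 2`, this includes the requirement that `F u` is a measurable function and that the function
`χ F u` is a tempered distribution. -/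
def HSubmodule (n : ℕ) (p : ℝ≥0∞) [Fact (1 ≤ p)] (χ : Rn n → ℝ) :
    Submodule ℂ 𝓢'(Rn n, ℂ) where
  carrier := {u | ∃ v, IsImage p χ u v}
  add_mem' := fun ⟨v, h⟩ ⟨v', h'⟩ => ⟨v + v', h.add h'⟩
  zero_mem' := ⟨0, IsImage.zero⟩
  smul_mem' := fun c _ ⟨v, h⟩ => ⟨c • v, h.smul c⟩

/-- The space `H^χ_p(ℝⁿ)`, as a type of its own: it carries the topology of its norm (below) and
not the one induced by `𝓢'`. -/
def HSpace (n : ℕ) (p : ℝ≥0∞) [Fact (1 ≤ p)] (χ : Rn n → ℝ) (_hχ : Admissible p χ) : Type :=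
  ↥(HSubmodule n p χ)

namespace HSpace

variable {p : ℝ≥0∞} [Fact (1 ≤ p)] {χ : Rn n → ℝ} {hχ : Admissible p χ}

instance : AddCommGroup (HSpace n p χ hχ) := inferInstanceAs (AddCommGroup ↥(HSubmodule n p χ))

instance : Module ℂ (HSpace n p χ hχ) := inferInstanceAs (Module ℂ ↥(HSubmodule n p χ))

/-- The inclusion `H^χ_p(ℝⁿ) → 𝓢'(ℝⁿ)`. -/
def toDistribution : HSpace n p χ hχ →ₗ[ℂ] 𝓢'(Rn n, ℂ) := (HSubmodule n p χ).subtype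

theorem exists_isImage (u : HSpace n p χ hχ) : ∃ v, IsImage p χ (toDistribution u) v := u.2

/-- The linear map `u ↦ F⁻¹ χ F u` from `H^χ_p(ℝⁿ)` to `L_p(ℝⁿ)`. -/
def image : HSpace n p χ hχ →ₗ[ℂ] Lp ℂ p (volume : Measure (Rn n)) where
  toFun u := (exists_isImage u).choose
  map_add' u u' := IsImage.unique hχ (exists_isImage (u + u')).choose_spec <| by
    rw [map_add]
    exact (exists_isImage u).choose_spec.add (exists_isImage u').choose_spec
  map_smul' c u := IsImage.unique hχ (exists_isImage (c • u)).choose_spec <| by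
    rw [map_smul]
    exact (exists_isImage u).choose_spec.smul c

theorem isImage_image (u : HSpace n p χ hχ) : IsImage p χ (toDistribution u) (image u) :=
  (exists_isImage u).choose_spec

/-- `H^χ_p(ℝⁿ)` carries the norm `‖u‖ = ‖F⁻¹ χ F u‖_{L_p}` and its topology. (That `‖u‖ = 0` only
for `u = 0` is not needed to define these.) -/
instance : SeminormedAddCommGroup (HSpace n p χ hχ) :=
  SeminormedAddCommGroup.induced _ _ (image (hχ := hχ))

theorem norm_def (u : HSpace n p χ hχ) : ‖u‖ = ‖image u‖ := rfl

instance : NormedSpace ℂ (HSpace n p χ hχ) where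
  norm_smul_le c u := by rw [norm_def, norm_def, map_smul, norm_smul]

end HSpace

end GenSobolev

end

/-!
Let `m = 2n⁺ > n`. If `g` is a Schwartz function, or is of class `C^m` with compact support, then
the derivatives of `χ g` up to order `m` decay rapidly, so `F⁻¹ (χ g)` is `O((1 + |x|)^(-m))` and
belongs to every `L_p`, with continuous dependence on `g`. The inequality defining `𝒦`, applied to
`0 = -ξ + ξ`, bounds `χ⁻¹` polynomially; hence the derivatives of `χ⁻¹` up to order `m` have
polynomial growth too, and `F (χ⁻¹ g)` belongs to every `L_q`.

* For `φ ∈ 𝓢`, the function `F⁻¹ χ F φ ∈ L_p` depends continuously on `φ`.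
* If `v = F⁻¹ χ F u`, then `u(φ) = ∫ v · F (χ⁻¹ F⁻¹ φ)`, first for `F⁻¹ φ` of compact support and
  then for all `φ ∈ 𝓢`. By Hölder's inequality, `u(φ)` depends continuously on `v ∈ L_p`.
* The functions `F⁻¹ ψ` with `ψ ∈ C_c^∞` are dense in `L_p`, and `F⁻¹ ψ` is the limit of
  `F⁻¹ (χ g_j)` for test functions `g_j` converging to `χ⁻¹ ψ`.

Since `χ⁻¹ ψ` is only of class `C^m`, the test functions converge to it in `C_c^m` and not in `𝓢`;
this is why the estimates for `F⁻¹ (χ g)` use no more than `m` derivatives of `g`.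
-/

noncomputable section

namespace GenSobolev

open Filter Topology

section Growth

variable {E F : Type*} [NormedAddCommGroup E] [NormedSpace ℝ E]
  [NormedAddCommGroup F] [NormedSpace ℝ F] {N K r : ℕ}

/-- `f` is of class `C^N` and its derivatives up to order `N` grow at most polynomially. -/
structure HasPolyGrowth (N : ℕ) (f : E → F) : Prop where
  contDiff : ContDiff ℝ N f
  exists_bound : ∃ (C : ℝ) (L : ℕ), 0 ≤ C ∧
    ∀ k ≤ N, ∀ x, ‖iteratedFDeriv ℝ k f x‖ ≤ C * (1 + ‖x‖) ^ L

/-- `f` is of class `C^N` and its derivatives up to order `N` are bounded by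
`M (1 + ‖x‖) ^ (-r)`. The bound `M` is explicit, so that it can play the role of a norm of `f`. -/
structure HasDecay (N r : ℕ) (f : E → F) (M : ℝ) : Prop where
  contDiff : ContDiff ℝ N f
  bound : ∀ k ≤ N, ∀ x, (1 + ‖x‖) ^ r * ‖iteratedFDeriv ℝ k f x‖ ≤ M

theorem norm_iteratedFDeriv_smul_le_of_bound {f : E → ℝ} {g : E → F}
    (hf : ContDiff ℝ N f) (hg : ContDiff ℝ N g) {x : E} {A B : ℝ}
    (hfA : ∀ k ≤ N, ‖iteratedFDeriv ℝ k f x‖ ≤ A) (hgB : ∀ k ≤ N, ‖iteratedFDeriv ℝ k g x‖ ≤ B)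
    {k : ℕ} (hk : k ≤ N) :
    ‖iteratedFDeriv ℝ k (fun y => f y • g y) x‖ ≤ 2 ^ N * (A * B) := by
  have hA : 0 ≤ A := (norm_nonneg _).trans (hfA 0 (Nat.zero_le N))
  have hB : 0 ≤ B := (norm_nonneg _).trans (hgB 0 (Nat.zero_le N))
  calc ‖iteratedFDeriv ℝ k (fun y => f y • g y) x‖
      ≤ ∑ i ∈ Finset.range (k + 1), (k.choose i : ℝ) * ‖iteratedFDeriv ℝ i f x‖ *
          ‖iteratedFDeriv ℝ (k - i) g x‖ :=
        norm_iteratedFDeriv_smul_le hf hg x (by exact_mod_cast hk)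
    _ ≤ ∑ i ∈ Finset.range (k + 1), (k.choose i : ℝ) * (A * B) := by
        refine Finset.sum_le_sum fun i hi => ?_
        have hi' : i ≤ k := Nat.lt_succ_iff.1 (Finset.mem_range.1 hi)
        rw [mul_assoc]
        gcongr
        exacts [hfA i (hi'.trans hk), hgB _ ((Nat.sub_le k i).trans hk)]
    _ = 2 ^ k * (A * B) := by
        rw [← Finset.sum_mul]
        exact_mod_cast congrArg (fun s : ℕ => (s : ℝ) * (A * B)) (Nat.sum_range_choose k)
    _ ≤ 2 ^ N * (A * B) := by
        gcongr
        exact one_le_two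

theorem HasPolyGrowth.mono {f : E → F} (hf : HasPolyGrowth N f) (h : K ≤ N) :
    HasPolyGrowth K f := by
  obtain ⟨C, L, hC, hb⟩ := hf.exists_bound
  exact ⟨hf.contDiff.of_le (by exact_mod_cast h), C, L, hC, fun k hk => hb k (hk.trans h)⟩

theorem hasPolyGrowth_zero_iff {f : E → F} : HasPolyGrowth 0 f ↔
    Continuous f ∧ ∃ (C : ℝ) (L : ℕ), 0 ≤ C ∧ ∀ x, ‖f x‖ ≤ C * (1 + ‖x‖) ^ L :=
  ⟨fun ⟨hf, C, L, hC, hb⟩ => ⟨hf.continuous, C, L, hC, by simpa using hb⟩,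
    fun ⟨hf, C, L, hC, hb⟩ => ⟨contDiff_zero.2 hf, C, L, hC, by simpa using hb⟩⟩

theorem hasPolyGrowth_const (N : ℕ) (c : F) : HasPolyGrowth N (fun _ : E => c) := by
  refine ⟨contDiff_const, ‖c‖, 0, norm_nonneg c, fun k _ x => ?_⟩
  rcases k.eq_zero_or_pos with rfl | hk
  · simp
  · simp [iteratedFDeriv_const_of_ne hk.ne']

theorem HasPolyGrowth.neg {f : E → F} (hf : HasPolyGrowth N f) :
    HasPolyGrowth N (fun x => -f x) := by
  obtain ⟨C, L, hC, hb⟩ := hf.exists_bound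
  refine ⟨hf.contDiff.neg, C, L, hC, fun k hk x => ?_⟩
  have h : iteratedFDeriv ℝ k (fun y => -f y) x = -iteratedFDeriv ℝ k f x :=
    iteratedFDeriv_neg_apply
  rw [h, norm_neg]
  exact hb k hk x

theorem HasPolyGrowth.smul {f : E → ℝ} {g : E → F} (hf : HasPolyGrowth N f)
    (hg : HasPolyGrowth N g) : HasPolyGrowth N (fun x => f x • g x) := by
  obtain ⟨C, L, hC, hb⟩ := hf.exists_bound
  obtain ⟨C', L', hC', hb'⟩ := hg.exists_bound
  refine ⟨hf.contDiff.smul hg.contDiff, 2 ^ N * (C * C'), L + L', by positivity, fun k hk x => ?_⟩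
  refine (norm_iteratedFDeriv_smul_le_of_bound hf.contDiff hg.contDiff (fun k hk => hb k hk x)
    (fun k hk => hb' k hk x) hk).trans_eq ?_
  rw [pow_add]
  ring

theorem HasPolyGrowth.fderiv_right {f : E → F} (hf : HasPolyGrowth (N + 1) f) :
    HasPolyGrowth N (fderiv ℝ f) := by
  obtain ⟨C, L, hC, hb⟩ := hf.exists_bound
  refine ⟨hf.contDiff.fderiv_right (by norm_cast), C, L, hC, fun k hk x => ?_⟩
  rw [norm_iteratedFDeriv_fderiv]
  exact hb _ (Nat.succ_le_succ hk) x

theorem HasPolyGrowth.of_fderiv {f : E → F} (hd : Differentiable ℝ f) (h₀ : HasPolyGrowth 0 f)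
    (h₁ : HasPolyGrowth N (fderiv ℝ f)) : HasPolyGrowth (N + 1) f := by
  obtain ⟨-, C, L, hC, hb⟩ := hasPolyGrowth_zero_iff.1 h₀
  obtain ⟨C', L', _, hb'⟩ := h₁.exists_bound
  refine ⟨?_, max C C', max L L', le_max_of_le_left hC, fun k hk x => ?_⟩
  · exact_mod_cast contDiff_succ_iff_fderiv.2
      ⟨hd, fun h => absurd h (WithTop.natCast_ne_top N), h₁.contDiff⟩
  rcases k with _ | k
  · rw [norm_iteratedFDeriv_zero]
    exact (hb x).trans (by gcongr <;> simp)
  · rw [← norm_iteratedFDeriv_fderiv]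
    exact (hb' k (Nat.le_of_succ_le_succ hk) x).trans (by gcongr <;> simp)

theorem HasPolyGrowth.inv {f : E → ℝ} (hf : HasPolyGrowth N f) (hne : ∀ x, f x ≠ 0)
    (hinv : HasPolyGrowth 0 fun x => (f x)⁻¹) : HasPolyGrowth N fun x => (f x)⁻¹ := by
  induction N with
  | zero => exact hinv
  | succ N ih =>
    have hd : Differentiable ℝ f := hf.contDiff.differentiable (by simp)
    have hderiv (x : E) : HasFDerivAt (fun y => (f y)⁻¹)
        (-((f x)⁻¹ • (f x)⁻¹ • fderiv ℝ f x)) x := by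
      rw [smul_smul, ← mul_inv, ← sq, ← neg_smul]
      exact (hasDerivAt_inv (hne x)).comp_hasFDerivAt x (hd x).hasFDerivAt
    have hI := ih (hf.mono N.le_succ)
    refine .of_fderiv (fun x => (hderiv x).differentiableAt) hinv ?_
    rw [funext fun x => (hderiv x).fderiv]
    exact (hI.smul (hI.smul hf.fderiv_right)).neg

theorem HasDecay.nonneg {f : E → F} {M : ℝ} (hf : HasDecay N r f M) : 0 ≤ M :=
  le_trans (by positivity) (hf.bound 0 N.zero_le 0)

theorem HasDecay.norm_iteratedFDeriv_le {f : E → F} {M : ℝ} (hf : HasDecay N r f M) {k : ℕ}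
    (hk : k ≤ N) (x : E) : ‖iteratedFDeriv ℝ k f x‖ ≤ M / (1 + ‖x‖) ^ r := by
  rw [le_div_iff₀' (by positivity)]
  exact hf.bound k hk x

theorem HasDecay.norm_le_mul_norm {f : E → F} {M : ℝ} (hf : HasDecay N r f M) (x : E) :
    ‖f x‖ ≤ M * ‖((1 + ‖x‖) ^ r)⁻¹‖ := by
  rw [Real.norm_of_nonneg (by positivity), ← div_eq_mul_inv]
  simpa using hf.norm_iteratedFDeriv_le N.zero_le x

theorem hasDecay_zero_iff {f : E → F} {M : ℝ} : HasDecay 0 r f M ↔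
    Continuous f ∧ ∀ x, (1 + ‖x‖) ^ r * ‖f x‖ ≤ M :=
  ⟨fun ⟨hf, hb⟩ => ⟨hf.continuous, by simpa using hb⟩,
    fun ⟨hf, hb⟩ => ⟨contDiff_zero.2 hf, by simpa using hb⟩⟩

theorem HasPolyGrowth.exists_hasDecay_smul {m : E → ℝ} (hm : HasPolyGrowth N m) (F : Type*)
    [NormedAddCommGroup F] [NormedSpace ℝ F] (r : ℕ) :
    ∃ (A : ℝ) (s : ℕ), 0 ≤ A ∧ ∀ (f : E → F) (M : ℝ), HasDecay N s f M →
      HasDecay N r (fun x => m x • f x) (A * M) := by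
  obtain ⟨C, L, hC, hb⟩ := hm.exists_bound
  refine ⟨2 ^ N * C, r + L, by positivity, fun f M hf => ⟨hm.contDiff.smul hf.contDiff,
    fun k hk x => ?_⟩⟩
  calc (1 + ‖x‖) ^ r * ‖iteratedFDeriv ℝ k (fun x => m x • f x) x‖
      ≤ (1 + ‖x‖) ^ r * (2 ^ N * (C * (1 + ‖x‖) ^ L * (M / (1 + ‖x‖) ^ (r + L)))) := by
        gcongr
        exact norm_iteratedFDeriv_smul_le_of_bound hm.contDiff hf.contDiff
          (fun i hi => hb i hi x) (fun i hi => hf.norm_iteratedFDeriv_le hi x) hk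
    _ = 2 ^ N * C * M := by
        have : 0 < 1 + ‖x‖ := by positivity
        rw [pow_add]
        field_simp

theorem hasDecay_schwartz (𝕜 : Type*) [NormedField 𝕜] [NormedSpace 𝕜 F] [SMulCommClass ℝ 𝕜 F]
    (N r : ℕ) (f : 𝓢(E, F)) :
    HasDecay N r f (2 ^ r * (Finset.Iic (r, N)).sup (schwartzSeminormFamily 𝕜 E F) f) :=
  ⟨f.smooth N, fun _ hk x => SchwartzMap.one_add_le_sup_seminorm_apply (m := (r, N)) le_rfl hk f x⟩

theorem HasDecay.seminorm_le (𝕜 : Type*) [NormedField 𝕜] [NormedSpace 𝕜 F] [SMulCommClass ℝ 𝕜 F]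
    {f : 𝓢(E, F)} {M : ℝ} (hf : HasDecay N r f M) : SchwartzMap.seminorm 𝕜 r N f ≤ M := by
  refine f.seminorm_le_bound 𝕜 r N hf.nonneg fun x => le_trans ?_ (hf.bound N le_rfl x)
  gcongr
  exact le_add_of_nonneg_left zero_le_one

theorem hasDecay_of_tsupport_subset (r : ℕ) {f : E → F} {R ε : ℝ} (hf : ContDiff ℝ N f)
    (hs : tsupport f ⊆ Metric.closedBall 0 R) (hε : 0 ≤ ε)
    (hb : ∀ k ≤ N, ∀ x, ‖iteratedFDeriv ℝ k f x‖ ≤ ε) : HasDecay N r f ((1 + |R|) ^ r * ε) := by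
  refine ⟨hf, fun k hk x => ?_⟩
  by_cases hx : x ∈ tsupport f
  · have hxR : ‖x‖ ≤ |R| := (mem_closedBall_zero_iff.1 (hs hx)).trans (le_abs_self R)
    gcongr
    exact hb k hk x
  · have h0 : iteratedFDeriv ℝ k f x = 0 :=
      Function.notMem_support.1 fun h => hx (support_iteratedFDeriv_subset k h)
    rw [h0, norm_zero, mul_zero]
    positivity

theorem HasPolyGrowth.exists_hasDecay_smul_schwartz {m : E → ℝ} (hm : HasPolyGrowth N m) (r : ℕ) :
    ∃ (s : Finset (ℕ × ℕ)) (C : ℝ), 0 ≤ C ∧ ∀ ψ : 𝓢(E, ℂ),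
      HasDecay N r (fun x => m x • ψ x) (C * s.sup (schwartzSeminormFamily ℂ E ℂ) ψ) := by
  obtain ⟨A, s, hA, h⟩ := hm.exists_hasDecay_smul ℂ r
  refine ⟨Finset.Iic (s, N), A * 2 ^ s, by positivity, fun ψ => ?_⟩
  rw [mul_assoc]
  exact h _ _ (hasDecay_schwartz ℂ N s ψ)

end Growth

section Approximation

universe u

section Convergence

variable {E F ι : Type*} [NormedAddCommGroup E] [NormedSpace ℝ E]
  [NormedAddCommGroup F] [NormedSpace ℝ F] {N : ℕ} {h : ι → E → F} {l : Filter ι} {g : E → F}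

/-- Convergence `h i → g` along `l` in the space of compactly supported functions of class `C^N`:
the supports lie in a common ball, and the derivatives up to order `N` converge uniformly. -/
structure TendstoCompactContDiff (N : ℕ) (h : ι → E → F) (l : Filter ι) (g : E → F) : Prop where
  contDiff : ∀ i, ContDiff ℝ N (h i)
  contDiff_limit : ContDiff ℝ N g
  exists_closedBall : ∃ R, (∀ i, tsupport (h i) ⊆ Metric.closedBall 0 R) ∧
    tsupport g ⊆ Metric.closedBall 0 R
  tendstoUniformly : ∀ k ≤ N,
    TendstoUniformly (fun i => iteratedFDeriv ℝ k (h i)) (iteratedFDeriv ℝ k g) l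

theorem TendstoCompactContDiff.eventually_hasDecay_sub (H : TendstoCompactContDiff N h l g) (r : ℕ)
    {ε : ℝ} (hε : 0 < ε) : ∀ᶠ i in l, HasDecay N r (fun x => h i x - g x) ε := by
  obtain ⟨R, hhR, hgR⟩ := H.exists_closedBall
  set δ := ε / (1 + |R|) ^ r
  have hδ : 0 < δ := by positivity
  have hδε : (1 + |R|) ^ r * δ = ε := mul_div_cancel₀ _ (by positivity)
  have hclose : ∀ᶠ i in l, ∀ k ∈ Set.Iic N, ∀ x,
      dist (iteratedFDeriv ℝ k g x) (iteratedFDeriv ℝ k (h i) x) < δ :=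
    (eventually_all_finite (Set.finite_Iic N)).2 fun k hk =>
      Metric.tendstoUniformly_iff.1 (H.tendstoUniformly k hk) δ hδ
  filter_upwards [hclose] with i hi
  rw [← hδε]
  refine hasDecay_of_tsupport_subset r ((H.contDiff i).sub H.contDiff_limit)
    ((tsupport_sub _ _).trans (Set.union_subset (hhR i) hgR)) hδ.le fun k hk x => ?_
  have hk' : (k : WithTop ℕ∞) ≤ N := by exact_mod_cast hk
  have hsub : iteratedFDeriv ℝ k (fun x => h i x - g x) x =
      iteratedFDeriv ℝ k (h i) x - iteratedFDeriv ℝ k g x :=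
    iteratedFDeriv_sub_apply ((H.contDiff i).of_le hk').contDiffAt
      (H.contDiff_limit.of_le hk').contDiffAt
  rw [hsub, ← dist_eq_norm, dist_comm]
  exact (hi k hk x).le

theorem TendstoCompactContDiff.tendstoUniformly_coe (H : TendstoCompactContDiff N h l g) :
    TendstoUniformly h g l := by
  refine Metric.tendstoUniformly_iff.2 fun ε hε => ?_
  filter_upwards [Metric.tendstoUniformly_iff.1 (H.tendstoUniformly 0 N.zero_le) ε hε] with i hi x
  simpa only [iteratedFDeriv_zero_eq_comp, Function.comp_apply, LinearIsometryEquiv.dist_map]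
    using hi x

end Convergence

section Mollification

variable {E F : Type u} [NormedAddCommGroup E] [NormedSpace ℝ E] [FiniteDimensional ℝ E]
  [NormedAddCommGroup F] [NormedSpace ℝ F] [MeasurableSpace E] [BorelSpace E]
  (μ : Measure E) [μ.IsAddHaarMeasure]

/-- The mollification of `g` with a smooth bump function. -/
def mollify {E F : Type*} [NormedAddCommGroup E] [NormedSpace ℝ E] [HasContDiffBump E]
    [NormedAddCommGroup F] [NormedSpace ℝ F] [MeasurableSpace E] (μ : Measure E)
    (b : ContDiffBump (0 : E)) (g : E → F) : E → F :=
  convolution (b.normed μ) g (ContinuousLinearMap.lsmul ℝ ℝ) μ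

theorem fderiv_mollify (b : ContDiffBump (0 : E)) {g : E → F} (hg : HasCompactSupport g)
    (hg₁ : ContDiff ℝ 1 g) : fderiv ℝ (mollify μ b g) = mollify μ b (fderiv ℝ g) := by
  ext1 x
  have h := HasCompactSupport.hasFDerivAt_convolution_right (μ := μ)
    (ContinuousLinearMap.lsmul ℝ ℝ : ℝ →L[ℝ] F →L[ℝ] F) hg
    (b.continuous_normed (μ := μ)).locallyIntegrable hg₁ x
  exact h.fderiv.trans (integral_congr_ae (ae_of_all _ fun t => by ext v; simp))

theorem tendstoUniformly_iteratedFDeriv_mollify {ι : Type*} {l : Filter ι} [CompleteSpace F]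
    {b : ι → ContDiffBump (0 : E)} (hb : Tendsto (fun i => (b i).rOut) l (𝓝 0)) {k : ℕ}
    {g : E → F} (hg : HasCompactSupport g) (hgk : ContDiff ℝ k g) :
    TendstoUniformly (fun i => iteratedFDeriv ℝ k (mollify μ (b i) g))
      (iteratedFDeriv ℝ k g) l := by
  induction k generalizing F with
  | zero =>
    have hunif : TendstoUniformly (fun i => mollify μ (b i) g) g l := by
      refine Metric.tendstoUniformly_iff.2 fun ε hε => ?_
      obtain ⟨δ, hδ, h⟩ := Metric.uniformContinuous_iff.1
        (hg.uniformContinuous_of_continuous hgk.continuous) (ε / 2) (half_pos hε)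
      filter_upwards [hb.eventually_lt_const hδ] with i hi x
      rw [dist_comm]
      exact (ContDiffBump.dist_normed_convolution_le hgk.continuous.aestronglyMeasurable
        fun y hy => (h (hy.trans hi)).le).trans_lt (half_lt_self hε)
    simp only [iteratedFDeriv_zero_eq_comp]
    exact (LinearIsometryEquiv.isometry _).uniformContinuous.comp_tendstoUniformly hunif
  | succ k ih =>
    have hg₁ : ContDiff ℝ 1 g := hgk.of_le (by norm_cast; omega)
    have hsucc (f : E → F) : iteratedFDeriv ℝ (k + 1) f =
        (continuousMultilinearCurryRightEquiv' ℝ k E F).symm ∘ iteratedFDeriv ℝ k (fderiv ℝ f) :=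
      funext fun _ => iteratedFDeriv_succ_eq_comp_right
    simp only [hsucc, fun i => fderiv_mollify μ (b i) hg hg₁]
    exact (LinearIsometryEquiv.isometry _).uniformContinuous.comp_tendstoUniformly
      (ih (hg.fderiv ℝ) (hgk.fderiv_right (by norm_cast)))

theorem tsupport_mollify_subset (b : ContDiffBump (0 : E)) {g : E → F} {R : ℝ}
    (hgR : tsupport g ⊆ Metric.closedBall 0 R) :
    tsupport (mollify μ b g) ⊆ Metric.closedBall 0 (b.rOut + R) := by
  refine closure_minimal ((support_convolution_subset _).trans ?_) Metric.isClosed_closedBall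
  rintro _ ⟨y, hy, z, hz, rfl⟩
  rw [b.support_normed_eq, mem_ball_zero_iff] at hy
  have hzR := mem_closedBall_zero_iff.1 (hgR (subset_tsupport _ hz))
  exact mem_closedBall_zero_iff.2 ((norm_add_le y z).trans (add_le_add hy.le hzR))

theorem exists_schwartz_tendstoCompactContDiff [CompleteSpace F] {N : ℕ} {g : E → F}
    (hg : HasCompactSupport g) (hgN : ContDiff ℝ N g) :
    ∃ h : ℕ → 𝓢(E, F), TendstoCompactContDiff N (fun j => h j) atTop g := by
  let μ : Measure E := Measure.addHaar
  obtain ⟨R, hR⟩ := hg.isCompact.isBounded.subset_closedBall (0 : E)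
  let b (j : ℕ) : ContDiffBump (0 : E) :=
    ⟨1 / ((j : ℝ) + 1) / 2, 1 / ((j : ℝ) + 1), by positivity, half_lt_self (by positivity)⟩
  have hbR (j : ℕ) : Metric.closedBall (0 : E) ((b j).rOut + R) ⊆ Metric.closedBall 0 (1 + R) := by
    refine Metric.closedBall_subset_closedBall (add_le_add_left ?_ R)
    exact div_le_one_of_le₀ (le_add_of_nonneg_left j.cast_nonneg) (by positivity)
  have hsupp (j : ℕ) : HasCompactSupport (mollify μ (b j) g) :=
    (b j).hasCompactSupport_normed.convolution _ hg
  have hsmooth (j : ℕ) : ContDiff ℝ ∞ (mollify μ (b j) g) :=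
    (b j).hasCompactSupport_normed.contDiff_convolution_left _ (b j).contDiff_normed
      hgN.continuous.locallyIntegrable
  refine ⟨fun j => (hsupp j).toSchwartzMap (hsmooth j), fun j => contDiff_infty.1 (hsmooth j) N,
    hgN, ⟨1 + R, fun j => (tsupport_mollify_subset μ (b j) hR).trans (hbR j),
    hR.trans (Metric.closedBall_subset_closedBall (le_add_of_nonneg_left zero_le_one))⟩,
    fun k hk => ?_⟩
  exact tendstoUniformly_iteratedFDeriv_mollify μ tendsto_one_div_add_atTop_nhds_zero_nat hg
    (hgN.of_le (by exact_mod_cast hk))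

end Mollification

section Cutoff

variable {E F : Type*} [NormedAddCommGroup E] [NormedSpace ℝ E]
  [NormedAddCommGroup F] [NormedSpace ℝ F] {N r : ℕ}

theorem HasDecay.comp_smul_of_le_one {f : E → F} {M a : ℝ} (hf : HasDecay N 0 f M) (ha : |a| ≤ 1) :
    HasDecay N 0 (fun x => f (a • x)) M := by
  refine ⟨hf.contDiff.comp (contDiff_const_smul a), fun k hk x => ?_⟩
  rw [iteratedFDeriv_comp_const_smul a (hf.contDiff.of_le (by exact_mod_cast hk)), norm_smul,
    norm_pow, pow_zero, one_mul]
  exact (mul_le_of_le_one_left (norm_nonneg _) (pow_le_one₀ (norm_nonneg a) ha)).trans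
    (by simpa using hf.bound k hk (a • x))

theorem HasDecay.comp_smul_zero {f : E → F} {M : ℝ} (hf : HasDecay 0 r f M) {a : ℝ} (ha : a ≠ 0) :
    HasDecay 0 r (fun x => f (a • x)) ((1 + |a|⁻¹) ^ r * M) := by
  obtain ⟨hcont, hb⟩ := hasDecay_zero_iff.1 hf
  refine hasDecay_zero_iff.2 ⟨hcont.comp (continuous_const_smul a), fun x => ?_⟩
  have hnorm : 1 + ‖x‖ ≤ (1 + |a|⁻¹) * (1 + ‖a • x‖) := by
    have hx : ‖x‖ = |a|⁻¹ * ‖a • x‖ := by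
      rw [norm_smul, Real.norm_eq_abs, inv_mul_cancel_left₀ (abs_ne_zero.2 ha)]
    have ha' : 0 ≤ |a|⁻¹ := by positivity
    linarith [norm_nonneg (a • x)]
  calc (1 + ‖x‖) ^ r * ‖f (a • x)‖ ≤ ((1 + |a|⁻¹) * (1 + ‖a • x‖)) ^ r * ‖f (a • x)‖ := by gcongr
    _ = (1 + |a|⁻¹) ^ r * ((1 + ‖a • x‖) ^ r * ‖f (a • x)‖) := by rw [mul_pow, mul_assoc]
    _ ≤ (1 + |a|⁻¹) ^ r * M := by
        gcongr
        exact hb (a • x)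

theorem HasDecay.cutoff_sub_self {θ : E → ℝ} {B : ℝ} (hθ : HasDecay N 0 θ B)
    (hθ₁ : ∀ x, ‖x‖ ≤ 1 → θ x = 1) {a : ℝ} (ha : 0 < a) (ha₁ : a ≤ 1) {f : E → F} {M : ℝ}
    (hf : HasDecay N (r + 1) f M) :
    HasDecay N r (fun x => θ (a • x) • f x - f x) ((2 ^ N * B + 1) * M * a) := by
  have hθa : HasDecay N 0 (fun x => θ (a • x)) B := hθ.comp_smul_of_le_one (by rwa [abs_of_pos ha])
  have hM := hf.nonneg
  have hB := hθ.nonneg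
  refine ⟨(hθa.contDiff.smul hf.contDiff).sub hf.contDiff, fun k hk x => ?_⟩
  have hx : 0 < 1 + ‖x‖ := by positivity
  rcases lt_or_ge (a * ‖x‖) 1 with hax | hax
  · have hzero : (fun y => θ (a • y) • f y - f y) =ᶠ[𝓝 x] fun _ => 0 := by
      have hopen : IsOpen {y : E | a * ‖y‖ < 1} := isOpen_lt (by fun_prop) continuous_const
      filter_upwards [hopen.mem_nhds hax] with y hy
      rw [hθ₁ (a • y) (by rw [norm_smul, Real.norm_of_nonneg ha.le]; exact hy.le), one_smul,
        sub_self]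
    rw [(hzero.iteratedFDeriv ℝ k).eq_of_nhds, iteratedFDeriv_fun_zero, Pi.zero_apply, norm_zero,
      mul_zero]
    positivity
  · have hk' : (k : WithTop ℕ∞) ≤ N := by exact_mod_cast hk
    have hprod := norm_iteratedFDeriv_smul_le_of_bound hθa.contDiff hf.contDiff (x := x)
      (fun i hi => by simpa using hθa.bound i hi x)
      (fun i hi => hf.norm_iteratedFDeriv_le hi x) hk
    have hsub : iteratedFDeriv ℝ k (fun y => θ (a • y) • f y - f y) x =
        iteratedFDeriv ℝ k (fun y => θ (a • y) • f y) x - iteratedFDeriv ℝ k f x :=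
      iteratedFDeriv_sub_apply ((hθa.contDiff.smul hf.contDiff).of_le hk').contDiffAt
        (hf.contDiff.of_le hk').contDiffAt
    calc (1 + ‖x‖) ^ r * ‖iteratedFDeriv ℝ k (fun y => θ (a • y) • f y - f y) x‖
        ≤ (1 + ‖x‖) ^ r * (2 ^ N * (B * (M / (1 + ‖x‖) ^ (r + 1))) + M / (1 + ‖x‖) ^ (r + 1)) := by
          rw [hsub]
          gcongr
          exact (norm_sub_le _ _).trans (add_le_add hprod (hf.norm_iteratedFDeriv_le hk x))
      _ = (2 ^ N * B + 1) * M * (1 / (1 + ‖x‖)) := by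
          rw [pow_succ]
          field_simp
      _ ≤ (2 ^ N * B + 1) * M * a := by
          gcongr
          rw [div_le_iff₀ hx]
          linarith

theorem dense_hasCompactSupport [FiniteDimensional ℝ E] :
    Dense {ψ : 𝓢(E, F) | HasCompactSupport ψ} := by
  intro ψ
  let b : ContDiffBump (0 : E) := ⟨1, 2, one_pos, one_lt_two⟩
  let a (j : ℕ) : ℝ := 1 / ((j : ℝ) + 1)
  have ha (j : ℕ) : 0 < a j := by positivity
  have ha₁ (j : ℕ) : a j ≤ 1 :=
    div_le_one_of_le₀ (le_add_of_nonneg_left j.cast_nonneg) (by positivity)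
  have hsupp (j : ℕ) : HasCompactSupport fun x => b (a j • x) • ψ x :=
    (b.hasCompactSupport.comp_smul (ha j).ne').smul_right
  have hsmooth (j : ℕ) : ContDiff ℝ ∞ fun x => b (a j • x) • ψ x :=
    (b.contDiff.comp (contDiff_const_smul (a j))).smul (ψ.smooth _)
  let h (j : ℕ) : 𝓢(E, F) := (hsupp j).toSchwartzMap (hsmooth j)
  suffices Tendsto h atTop (𝓝 ψ) from
    mem_closure_of_tendsto this (Eventually.of_forall hsupp)
  rw [(schwartz_withSeminorms ℝ E F).tendsto_nhds h ψ]
  rintro ⟨r, N⟩ ε hε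
  have hθ := hasDecay_schwartz ℝ N 0 (b.hasCompactSupport.toSchwartzMap b.contDiff)
  obtain ⟨C, hdecay⟩ : ∃ C, ∀ j, HasDecay N r (h j - ψ) (C * a j) := ⟨_, fun j =>
    hθ.cutoff_sub_self (fun x hx => b.one_of_mem_closedBall (mem_closedBall_zero_iff.2 hx))
      (ha j) (ha₁ j) (hasDecay_schwartz ℝ N (r + 1) ψ)⟩
  have hlim : Tendsto (fun j => C * a j) atTop (𝓝 0) := by
    simpa only [mul_zero] using tendsto_one_div_add_atTop_nhds_zero_nat.const_mul C
  filter_upwards [hlim.eventually_lt_const hε] with j hj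
  exact (HasDecay.seminorm_le ℝ (f := h j - ψ) (hdecay j)).trans_lt hj

end Cutoff

end Approximation

section ScaledFourier

variable {E F : Type*} [NormedAddCommGroup E] [InnerProductSpace ℝ E] [FiniteDimensional ℝ E]
  [MeasurableSpace E] [BorelSpace E] [NormedAddCommGroup F] [NormedSpace ℂ F] {N r : ℕ}

section Integrability

theorem memLp_inv_one_add_norm_pow (hr : Module.finrank ℝ E < r) {q : ℝ≥0∞} (hq : 1 ≤ q) :
    MemLp (fun x : E => ((1 + ‖x‖) ^ r)⁻¹) q := by
  have hcont : Continuous fun x : E => ((1 + ‖x‖) ^ r)⁻¹ :=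
    (by fun_prop : Continuous fun x : E => (1 + ‖x‖) ^ r).inv₀ fun x => by positivity
  rcases eq_or_ne q ⊤ with rfl | hq'
  · refine memLp_top_of_bound hcont.aestronglyMeasurable 1 (ae_of_all _ fun x => ?_)
    rw [Real.norm_of_nonneg (by positivity)]
    exact inv_le_one_of_one_le₀ (one_le_pow₀ (le_add_of_nonneg_right (norm_nonneg x)))
  rw [← integrable_norm_rpow_iff hcont.aestronglyMeasurable (zero_lt_one.trans_le hq).ne' hq']
  have hq₁ : 1 ≤ q.toReal := by simpa using ENNReal.toReal_mono hq' hq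
  have hr' : (Module.finrank ℝ E : ℝ) < r := by exact_mod_cast hr
  refine (integrable_one_add_norm (hr'.trans_le (le_mul_of_one_le_right r.cast_nonneg hq₁))).congr
    (ae_of_all _ fun x => ?_)
  have hx : (0 : ℝ) ≤ 1 + ‖x‖ := by positivity
  simp only [Real.norm_of_nonneg (inv_nonneg.2 (pow_nonneg hx r)), Real.rpow_neg hx,
    Real.rpow_mul hx, Real.rpow_natCast, Real.inv_rpow (pow_nonneg hx r)]

theorem integrable_inv_one_add_norm_pow (hr : Module.finrank ℝ E < r) :
    Integrable fun x : E => ((1 + ‖x‖) ^ r)⁻¹ :=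
  memLp_one_iff_integrable.1 (memLp_inv_one_add_norm_pow hr le_rfl)

theorem HasDecay.memLp (hr : Module.finrank ℝ E < r) {f : E → F} {M : ℝ} (hf : HasDecay N r f M)
    {q : ℝ≥0∞} (hq : 1 ≤ q) : MemLp f q :=
  (memLp_inv_one_add_norm_pow hr hq).of_le_mul hf.contDiff.continuous.aestronglyMeasurable
    (ae_of_all _ hf.norm_le_mul_norm)

theorem HasDecay.integrable (hr : Module.finrank ℝ E < r) {f : E → F} {M : ℝ}
    (hf : HasDecay N r f M) : Integrable f :=
  memLp_one_iff_integrable.1 (hf.memLp hr le_rfl)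

theorem exists_norm_toLp_le_of_hasDecay (F : Type*) [NormedAddCommGroup F] [NormedSpace ℂ F]
    (N : ℕ) (hr : Module.finrank ℝ E < r) {q : ℝ≥0∞} (hq : 1 ≤ q) :
    ∃ K : ℝ, 0 ≤ K ∧ ∀ (f : E → F) (M : ℝ) (hf : HasDecay N r f M),
      ‖(hf.memLp hr hq).toLp‖ ≤ K * M := by
  have hw := memLp_inv_one_add_norm_pow hr hq
  refine ⟨‖hw.toLp‖, ENNReal.toReal_nonneg, fun f M hf => ?_⟩
  rw [mul_comm]
  refine Lp.norm_le_mul_norm_of_ae_le_mul ?_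
  filter_upwards [(hf.memLp hr hq).coeFn_toLp, hw.coeFn_toLp] with x hfx hwx
  rw [hfx, hwx]
  exact hf.norm_le_mul_norm x

theorem HasDecay.integrable_iteratedFDeriv (hr : Module.finrank ℝ E < r) {f : E → F} {M : ℝ}
    (hf : HasDecay N r f M) {k : ℕ} (hk : k ≤ N) : Integrable (iteratedFDeriv ℝ k f) :=
  ((integrable_inv_one_add_norm_pow hr).const_mul M).mono'
    (hf.contDiff.continuous_iteratedFDeriv (by exact_mod_cast hk)).aestronglyMeasurable
    (ae_of_all _ fun x => hf.norm_iteratedFDeriv_le hk x)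

theorem HasDecay.integral_norm_iteratedFDeriv_le (hr : Module.finrank ℝ E < r) {f : E → F} {M : ℝ}
    (hf : HasDecay N r f M) {k : ℕ} (hk : k ≤ N) :
    ∫ x, ‖iteratedFDeriv ℝ k f x‖ ≤ M * ∫ x : E, ((1 + ‖x‖) ^ r)⁻¹ := by
  rw [← integral_const_mul]
  exact integral_mono (hf.integrable_iteratedFDeriv hr hk).norm
    ((integrable_inv_one_add_norm_pow hr).const_mul M) fun x => hf.norm_iteratedFDeriv_le hk x

end Integrability

section FourierDecay

theorem HasDecay.pow_mul_norm_fourier_le (hr : Module.finrank ℝ E < r) {f : E → F} {M : ℝ}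
    (hf : HasDecay N r f M) {j : ℕ} (hj : j ≤ N) (x : E) :
    ‖x‖ ^ j * ‖𝓕 f x‖ ≤ 2 ^ j * ((j + 1) * (M * ∫ y : E, ((1 + ‖y‖) ^ r)⁻¹)) := by
  have hint (k i : ℕ) (hk : (k : ℕ∞) ≤ (0 : ℕ)) (hi : (i : ℕ∞) ≤ N) :
      Integrable fun v => ‖v‖ ^ k * ‖iteratedFDeriv ℝ i f v‖ := by
    obtain rfl : k = 0 := by simpa using hk
    simpa only [pow_zero, one_mul] using
      (hf.integrable_iteratedFDeriv hr (by exact_mod_cast hi)).norm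
  have hbound := Real.pow_mul_norm_iteratedFDeriv_fourier_le (K := (0 : ℕ)) (N := N)
    (by exact_mod_cast hf.contDiff) hint (k := 0) le_rfl (by exact_mod_cast hj) x
  simp only [norm_iteratedFDeriv_zero, pow_zero, one_mul, Nat.cast_zero, mul_zero, zero_add,
    Finset.range_one, Finset.sum_product, Finset.sum_singleton] at hbound
  refine hbound.trans ?_
  gcongr
  refine (Finset.sum_le_card_nsmul _ _ _ fun i hi => hf.integral_norm_iteratedFDeriv_le hr
    ((Nat.lt_succ_iff.1 (Finset.mem_range.1 hi)).trans hj)).trans_eq ?_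
  simp

theorem continuous_fourier_of_integrable {f : E → F} (hf : Integrable f) : Continuous (𝓕 f) :=
  VectorFourier.fourierIntegral_continuous Real.continuous_fourierChar continuous_inner hf

theorem exists_hasDecay_fourier (F : Type*) [NormedAddCommGroup F] [NormedSpace ℂ F] (N : ℕ)
    (hr : Module.finrank ℝ E < r) :
    ∃ K : ℝ, 0 ≤ K ∧ ∀ (f : E → F) (M : ℝ), HasDecay N r f M → HasDecay 0 N (𝓕 f) (K * M) := by
  set I : ℝ := ∫ x : E, ((1 + ‖x‖) ^ r)⁻¹
  have : 0 ≤ I := integral_nonneg fun x => by positivity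
  refine ⟨2 ^ (N - 1) * (I + 2 ^ N * ((N + 1) * I)), by positivity, fun f M hf =>
    hasDecay_zero_iff.2 ⟨continuous_fourier_of_integrable (hf.integrable hr), fun x => ?_⟩⟩
  calc (1 + ‖x‖) ^ N * ‖𝓕 f x‖ ≤ 2 ^ (N - 1) * (1 ^ N + ‖x‖ ^ N) * ‖𝓕 f x‖ := by
        gcongr
        exact add_pow_le zero_le_one (norm_nonneg x) N
    _ = 2 ^ (N - 1) * (‖𝓕 f x‖ + ‖x‖ ^ N * ‖𝓕 f x‖) := by ring
    _ ≤ 2 ^ (N - 1) * (M * I + 2 ^ N * ((N + 1) * (M * I))) :=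
        mul_le_mul_of_nonneg_left (add_le_add
          (by simpa using hf.pow_mul_norm_fourier_le hr N.zero_le x)
          (hf.pow_mul_norm_fourier_le hr le_rfl x)) (by positivity)
    _ = 2 ^ (N - 1) * (I + 2 ^ N * ((N + 1) * I)) * M := by ring

end FourierDecay

/-- The rescaled Fourier transform `x ↦ c (𝓕 g)(a x)`. The Fourier transform with kernel
`exp (-i x·ξ)` and its inverse are both of this form. -/
def scaledFourier (c : ℂ) (a : ℝ) (g : E → ℂ) (x : E) : ℂ := c * 𝓕 g (a • x)

theorem exists_hasDecay_scaledFourier (N : ℕ) (hr : Module.finrank ℝ E < r) (c : ℂ) {a : ℝ}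
    (ha : a ≠ 0) :
    ∃ K : ℝ, 0 ≤ K ∧ ∀ (f : E → ℂ) (M : ℝ), HasDecay N r f M →
      HasDecay 0 N (scaledFourier c a f) (K * M) := by
  obtain ⟨K, hK, hfourier⟩ := exists_hasDecay_fourier (E := E) ℂ N hr
  refine ⟨‖c‖ * ((1 + |a|⁻¹) ^ N * K), by positivity, fun f M hf => ?_⟩
  obtain ⟨hcont, hb⟩ := hasDecay_zero_iff.1 ((hfourier f M hf).comp_smul_zero ha)
  refine hasDecay_zero_iff.2 ⟨hcont.const_mul c, fun x => ?_⟩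
  rw [scaledFourier, norm_mul, mul_left_comm, mul_assoc, mul_assoc]
  exact mul_le_mul_of_nonneg_left (hb x) (norm_nonneg c)

theorem scaledFourier_eq_fourierIntegral (c : ℂ) (a : ℝ) (g : E → ℂ) (x : E) :
    scaledFourier c a g x =
      c * VectorFourier.fourierIntegral Real.fourierChar volume (a • innerₗ E) g x := by
  simp [scaledFourier, Real.fourier_eq, VectorFourier.fourierIntegral, inner_smul_right]

theorem integral_scaledFourier_mul (c : ℂ) (a : ℝ) {f g : E → ℂ} (hf : Integrable f)
    (hg : Integrable g) :
    ∫ x, scaledFourier c a f x * g x = ∫ x, f x * scaledFourier c a g x := by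
  have hflip : (a • innerₗ E).flip = a • innerₗ E := by
    ext x y
    simp [real_inner_comm]
  have hpair := VectorFourier.integral_fourierIntegral_smul_eq_flip (L := a • innerₗ E)
    (μ := volume) (ν := volume) Real.continuous_fourierChar
    (by simpa using (continuous_inner (𝕜 := ℝ) (E := E)).const_mul a) hf hg
  simp only [hflip, smul_eq_mul] at hpair
  simp only [scaledFourier_eq_fourierIntegral, mul_assoc, mul_left_comm _ c]
  rw [integral_const_mul, integral_const_mul, hpair]

theorem scaledFourier_add (c : ℂ) (a : ℝ) {f g : E → ℂ} (hf : Integrable f) (hg : Integrable g) :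
    scaledFourier c a (f + g) = scaledFourier c a f + scaledFourier c a g := by
  have hadd : 𝓕 (f + g) = 𝓕 f + 𝓕 g :=
    (VectorFourier.fourierIntegral_add Real.continuous_fourierChar continuous_inner hf hg)
  funext x
  simp only [scaledFourier, hadd, Pi.add_apply, mul_add]

theorem scaledFourier_const_smul (c : ℂ) (a : ℝ) (z : ℂ) (g : E → ℂ) :
    scaledFourier c a (z • g) = z • scaledFourier c a g := by
  have hsmul : 𝓕 (z • g) = z • 𝓕 g :=
    VectorFourier.fourierIntegral_const_smul Real.fourierChar volume (innerₗ E) g z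
  funext x
  simp only [scaledFourier, hsmul, Pi.smul_apply, smul_eq_mul, mul_left_comm c]

theorem exists_memLp_scaledFourier (hN : Module.finrank ℝ E < N) (hr : Module.finrank ℝ E < r)
    (c : ℂ) {a : ℝ} (ha : a ≠ 0) {q : ℝ≥0∞} (hq : 1 ≤ q) :
    ∃ K : ℝ, 0 ≤ K ∧ ∀ (f : E → ℂ) (M : ℝ), HasDecay N r f M →
      ∃ h : MemLp (scaledFourier c a f) q, ‖h.toLp‖ ≤ K * M := by
  obtain ⟨K, hK, hdecay⟩ := exists_hasDecay_scaledFourier N hr c ha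
  obtain ⟨K', hK', hnorm⟩ := exists_norm_toLp_le_of_hasDecay (E := E) ℂ 0 hN hq
  refine ⟨K' * K, mul_nonneg hK' hK, fun f M hf => ⟨(hdecay f M hf).memLp hN hq, ?_⟩⟩
  rw [mul_assoc]
  exact hnorm _ _ (hdecay f M hf)

variable {m : E → ℝ} {q : ℝ≥0∞}

theorem HasPolyGrowth.integrable_smul_schwartz (hm : HasPolyGrowth N m) (ψ : 𝓢(E, ℂ)) :
    Integrable fun x => m x • ψ x := by
  obtain ⟨_, _, _, hdecay⟩ := hm.exists_hasDecay_smul_schwartz (Module.finrank ℝ E + 1)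
  exact (hdecay ψ).integrable (Nat.lt_succ_self _)

theorem HasPolyGrowth.exists_memLp_scaledFourier (hm : HasPolyGrowth N m)
    (hN : Module.finrank ℝ E < N) (c : ℂ) {a : ℝ} (ha : a ≠ 0) (hq : 1 ≤ q) :
    ∃ (s : Finset (ℕ × ℕ)) (C : ℝ), 0 ≤ C ∧ ∀ ψ : 𝓢(E, ℂ),
      ∃ h : MemLp (scaledFourier c a fun x => m x • ψ x) q,
        ‖h.toLp‖ ≤ C * s.sup (schwartzSeminormFamily ℂ E ℂ) ψ := by
  obtain ⟨s, C, hC, hdecay⟩ := hm.exists_hasDecay_smul_schwartz (Module.finrank ℝ E + 1)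
  obtain ⟨K, hK, hmem⟩ := GenSobolev.exists_memLp_scaledFourier hN (Nat.lt_succ_self _) c ha hq
  refine ⟨s, K * C, mul_nonneg hK hC, fun ψ => ?_⟩
  rw [mul_assoc]
  exact hmem _ _ (hdecay ψ)

theorem HasPolyGrowth.memLp_scaledFourier (hm : HasPolyGrowth N m) (hN : Module.finrank ℝ E < N)
    (c : ℂ) {a : ℝ} (ha : a ≠ 0) (hq : 1 ≤ q) (ψ : 𝓢(E, ℂ)) :
    MemLp (scaledFourier c a fun x => m x • ψ x) q :=
  let ⟨_, _, _, hmem⟩ := hm.exists_memLp_scaledFourier hN c ha hq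
  (hmem ψ).1

variable [Fact (1 ≤ q)]

/-- The operator `ψ ↦ c 𝓕 (m ψ) (a ·)` from the Schwartz space to `L_q`, for a multiplier `m` with
more than `dim E` derivatives of polynomial growth. -/
def scaledFourierLp (hm : HasPolyGrowth N m) (hN : Module.finrank ℝ E < N) (c : ℂ) {a : ℝ}
    (ha : a ≠ 0) : 𝓢(E, ℂ) →L[ℂ] Lp ℂ q (volume : Measure E) :=
  SchwartzMap.mkCLMtoNormedSpace
    (fun ψ => (hm.memLp_scaledFourier hN c ha Fact.out ψ).toLp)
    (fun f g => by
      rw [← MemLp.toLp_add]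
      congr 1
      rw [← scaledFourier_add c a (hm.integrable_smul_schwartz f) (hm.integrable_smul_schwartz g)]
      simp only [add_apply, smul_add, Pi.add_def])
    (fun z f => by
      rw [RingHom.id_apply, ← MemLp.toLp_const_smul]
      congr 1
      rw [← scaledFourier_const_smul]
      simp only [smul_apply, smul_comm _ z, Pi.smul_def])
    (by
      obtain ⟨s, C, hC, hmem⟩ := hm.exists_memLp_scaledFourier hN c ha (Fact.out : 1 ≤ q)
      exact ⟨s, C, hC, fun ψ => (hmem ψ).2⟩)

theorem coeFn_scaledFourierLp (hm : HasPolyGrowth N m) (hN : Module.finrank ℝ E < N) (c : ℂ)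
    {a : ℝ} (ha : a ≠ 0) (ψ : 𝓢(E, ℂ)) :
    (scaledFourierLp hm hN c ha ψ : Lp ℂ q (volume : Measure E)) =ᵐ[volume]
      scaledFourier c a fun x => m x • ψ x :=
  (hm.memLp_scaledFourier hN c ha Fact.out ψ).coeFn_toLp

theorem tendsto_scaledFourierLp {ι : Type*} {l : Filter ι} (hm : HasPolyGrowth N m)
    (hN : Module.finrank ℝ E < N) (c : ℂ) {a : ℝ} (ha : a ≠ 0) {h : ι → 𝓢(E, ℂ)} {g : E → ℂ}
    (H : TendstoCompactContDiff N (fun i => h i) l g) {G : Lp ℂ q (volume : Measure E)}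
    (hG : G =ᵐ[volume] scaledFourier c a fun x => m x • g x) :
    Tendsto (fun i => scaledFourierLp hm hN c ha (h i)) l (𝓝 G) := by
  have hr := Nat.lt_succ_self (Module.finrank ℝ E)
  obtain ⟨A, s, hA, hsmul⟩ := hm.exists_hasDecay_smul ℂ (Module.finrank ℝ E + 1)
  obtain ⟨K, hK, hmem⟩ := exists_memLp_scaledFourier hN hr c ha (Fact.out : 1 ≤ q)
  refine Metric.tendsto_nhds.2 fun ε hε => ?_
  set δ := ε / (K * A + 1)
  have hδ : 0 < δ := by positivity
  filter_upwards [H.eventually_hasDecay_sub s hδ] with i hi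
  have hdecay := hsmul _ _ hi
  obtain ⟨hD, hDnorm⟩ := hmem _ _ hdecay
  have hsplit : (fun x => m x • (h i) x) - (fun x => m x • (h i x - g x)) =
      fun x => m x • g x := by
    funext x
    simp only [Pi.sub_apply, smul_sub, sub_sub_cancel]
  have hg : Integrable fun x => m x • g x :=
    hsplit ▸ (hm.integrable_smul_schwartz (h i)).sub (hdecay.integrable hr)
  have hdiff : scaledFourierLp hm hN c ha (h i) - G = hD.toLp := by
    ext1
    filter_upwards [Lp.coeFn_sub (scaledFourierLp (q := q) hm hN c ha (h i)) G, hD.coeFn_toLp, hG,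
      coeFn_scaledFourierLp (q := q) hm hN c ha (h i)] with x hsub hDx hGx hTx
    rw [hsub, hDx, Pi.sub_apply, hGx, hTx, sub_eq_iff_eq_add, ← Pi.add_apply,
      ← scaledFourier_add c a (hdecay.integrable hr) hg, ← hsplit, add_sub_cancel]
  calc dist (scaledFourierLp hm hN c ha (h i)) G ≤ K * (A * δ) := by
        rw [dist_eq_norm, hdiff]
        exact hDnorm
    _ < (K * A + 1) * δ := by linarith
    _ = ε := mul_div_cancel₀ _ (by positivity)

end ScaledFourier

section Weights

variable {n : ℕ}

theorem finrank_lt_two_mul_plus (n : ℕ) : Module.finrank ℝ (Rn n) < 2 * plus n := by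
  rw [finrank_euclideanSpace_fin, plus]
  omega

theorem rpow_le_pow_natCeil {x : ℝ} (hx : 1 ≤ x) (l : ℝ) : x ^ l ≤ x ^ ⌈l⌉₊ := by
  rw [← Real.rpow_natCast]
  exact Real.rpow_le_rpow_of_exponent_le hx (Nat.le_ceil l)

theorem MemK.exists_inv_le {χ : Rn n → ℝ} (hχ : MemK χ) :
    ∃ (C : ℝ) (L : ℕ), 0 ≤ C ∧ ∀ x, (χ x)⁻¹ ≤ C * (1 + ‖x‖) ^ L := by
  obtain ⟨C, hC, l, -, hbound⟩ := hχ.exists_bound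
  have hχ₀ := hχ.pos 0
  refine ⟨C / χ 0, ⌈l⌉₊, by positivity, fun x => ?_⟩
  have hχx := hχ.pos x
  have hle : χ 0 ≤ C * (1 + ‖x‖) ^ ⌈l⌉₊ * χ x := calc
    χ 0 ≤ C * (1 + ‖x‖) ^ l * χ x := by simpa using hbound (-x) x
    _ ≤ C * (1 + ‖x‖) ^ ⌈l⌉₊ * χ x := by
      gcongr
      exact rpow_le_pow_natCeil (le_add_of_nonneg_right (norm_nonneg x)) l
  rwa [inv_le_iff_one_le_mul₀ hχx, div_mul_eq_mul_div, div_mul_eq_mul_div, le_div_iff₀ hχ₀,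
    one_mul]

theorem DerivBound.hasPolyGrowth {χ : Rn n → ℝ} (h : DerivBound χ)
    (hχ : ContDiff ℝ (2 * plus n : ℕ) χ) : HasPolyGrowth (2 * plus n) χ := by
  obtain ⟨C, hC, l, hl, hbound⟩ := h
  refine ⟨hχ, C, ⌈l⌉₊, hC.le, fun k hk x => (hbound k hk x).trans ?_⟩
  gcongr
  calc Real.sqrt (1 + ‖x‖ ^ 2) ^ l ≤ (1 + ‖x‖) ^ l :=
        Real.rpow_le_rpow (Real.sqrt_nonneg _) (sqrt_one_add_norm_sq_le x) hl.le
    _ ≤ (1 + ‖x‖) ^ ⌈l⌉₊ := rpow_le_pow_natCeil (le_add_of_nonneg_right (norm_nonneg x)) l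

variable {p : ℝ≥0∞} {χ : Rn n → ℝ}

theorem Admissible.memK (hχ : Admissible p χ) : MemK χ := by
  rcases le_or_gt p 2 with hp | hp
  · exact (hχ.1 hp).toMemK
  · exact (hχ.2 hp).toMemK

theorem Admissible.hasPolyGrowth (hχ : Admissible p χ) : HasPolyGrowth (2 * plus n) χ := by
  rcases le_or_gt p 2 with hp | hp
  · exact (hχ.1 hp).derivBound.hasPolyGrowth (hχ.1 hp).contDiff
  · exact (hχ.2 hp).derivBound.hasPolyGrowth (contDiff_infty.1 (hχ.2 hp).contDiff _)

theorem Admissible.hasPolyGrowth_inv (hχ : Admissible p χ) :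
    HasPolyGrowth (2 * plus n) fun x => (χ x)⁻¹ := by
  have hne (x : Rn n) : χ x ≠ 0 := (hχ.memK.pos x).ne'
  obtain ⟨C, L, hC, hle⟩ := hχ.memK.exists_inv_le
  refine hχ.hasPolyGrowth.inv hne (hasPolyGrowth_zero_iff.2
    ⟨hχ.hasPolyGrowth.contDiff.continuous.inv₀ hne, C, L, hC, fun x => ?_⟩)
  rw [Real.norm_of_nonneg (inv_nonneg.2 (hχ.memK.pos x).le)]
  exact hle x

theorem Admissible.exists_schwartz_tendsto_inv_smul (hχ : Admissible p χ) {ψ : 𝓢(Rn n, ℂ)}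
    (hψ : HasCompactSupport ψ) :
    ∃ g : ℕ → 𝓢(Rn n, ℂ),
      TendstoCompactContDiff (2 * plus n) (fun j => g j) atTop fun x => (χ x)⁻¹ • ψ x :=
  exists_schwartz_tendstoCompactContDiff (hψ.smul_left (f := fun x => (χ x)⁻¹))
    (hχ.hasPolyGrowth_inv.contDiff.smul (ψ.smooth _))

end Weights

section Fourier

variable {n : ℕ}

/-- The constant `(2π)⁻ⁿ` in the inversion formula, with the absolute value which the change of
variables formula produces. -/
def invConst (n : ℕ) : ℂ := ((|((2 * Real.pi) ^ n)⁻¹| : ℝ) : ℂ)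

theorem neg_inv_two_pi_ne_zero : (-(2 * Real.pi)⁻¹ : ℝ) ≠ 0 :=
  neg_ne_zero.2 (inv_ne_zero two_pi_ne_zero)

theorem coe_fourierS (φ : 𝓢(Rn n, ℂ)) :
    ⇑(fourierS n φ) = scaledFourier 1 (2 * Real.pi)⁻¹ φ := by
  funext x
  have h : fourierS n φ x = (𝓕 φ : 𝓢(Rn n, ℂ)) ((2 * Real.pi)⁻¹ • x) := rfl
  rw [h, SchwartzMap.fourier_coe, scaledFourier, one_mul]

theorem coe_fourierInvS (φ : 𝓢(Rn n, ℂ)) :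
    ⇑(fourierInvS n φ) = scaledFourier (invConst n) (-(2 * Real.pi)⁻¹) φ := by
  funext x
  have h : fourierInvS n φ x = 𝓕⁻ (fun v => φ ((2 * Real.pi) • v)) x := by
    change (𝓕⁻ (SchwartzMap.compCLMOfContinuousLinearEquiv ℂ
      (dilation n (2 * Real.pi) two_pi_ne_zero) φ) : 𝓢(Rn n, ℂ)) x = _
    rw [SchwartzMap.fourierInv_coe]
    rfl
  have hsubst := Measure.integral_comp_smul (volume : Measure (Rn n))
    (fun v => Real.fourierChar (-inner ℝ v (-(2 * Real.pi)⁻¹ • x)) • φ v) (2 * Real.pi)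
  rw [finrank_euclideanSpace_fin, Complex.real_smul] at hsubst
  rw [h, scaledFourier, Real.fourierInv_eq, Real.fourier_eq, invConst, ← hsubst]
  refine integral_congr_ae (ae_of_all _ fun v => ?_)
  have hinner : (-inner ℝ ((2 * Real.pi) • v) (-(2 * Real.pi)⁻¹ • x) : ℝ) = inner ℝ v x := by
    rw [real_inner_smul_left, real_inner_smul_right, neg_mul, mul_neg, neg_neg,
      mul_inv_cancel_left₀ two_pi_ne_zero]
  simp only [hinner]

theorem integral_mul_fourierS {f : Rn n → ℂ} (hf : Integrable f) (ψ : 𝓢(Rn n, ℂ)) :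
    ∫ x, f x * fourierS n ψ x = ∫ x, scaledFourier 1 (2 * Real.pi)⁻¹ f x * ψ x := by
  rw [coe_fourierS]
  exact (integral_scaledFourier_mul _ _ hf ψ.integrable).symm

theorem integral_scaledFourier_mul_fourierS {f : Rn n → ℂ} (hf : Integrable f)
    (ψ : 𝓢(Rn n, ℂ)) :
    ∫ x, scaledFourier (invConst n) (-(2 * Real.pi)⁻¹) f x * fourierS n ψ x =
      ∫ x, f x * ψ x := by
  rw [integral_scaledFourier_mul _ _ hf (fourierS n ψ).integrable, ← coe_fourierInvS,
    fourierInvS_fourierS]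

theorem fourierInvD_fourierD (u : 𝓢'(Rn n, ℂ)) : fourierInvD n (fourierD n u) = u := by
  ext φ
  rw [fourierInvD_apply, fourierD_apply, fourierS_fourierInvS]

theorem integrable_mul_schwartz {f : Rn n → ℂ} (hf : Integrable f) (ψ : 𝓢(Rn n, ℂ)) :
    Integrable fun x => f x * ψ x :=
  hf.mul_bdd (c := SchwartzMap.seminorm ℂ 0 0 ψ) ψ.continuous.aestronglyMeasurable
    (ae_of_all _ fun x => ψ.norm_le_seminorm ℂ x)

end Fourier

section IsFunction

variable {n : ℕ} {T : 𝓢'(Rn n, ℂ)} {f : Rn n → ℂ}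

theorem exists_schwartz_eqOn_one (n : ℕ) (R : ℝ) :
    ∃ φ : 𝓢(Rn n, ℂ), Set.EqOn φ 1 (Metric.closedBall 0 R) := by
  let b : ContDiffBump (0 : Rn n) := ⟨max R 1, max R 1 + 1, by positivity, lt_add_one _⟩
  have hb : HasCompactSupport (Complex.ofRealCLM ∘ b) := b.hasCompactSupport.comp_left rfl
  refine ⟨hb.toSchwartzMap (Complex.ofRealCLM.contDiff.comp b.contDiff), fun x hx => ?_⟩
  have hbx : b x = 1 :=
    b.one_of_mem_closedBall (Metric.closedBall_subset_closedBall (le_max_left R 1) hx)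
  exact congrArg Complex.ofReal hbx

theorem IsFunction.integrableOn_closedBall (hT : IsFunction T f) (R : ℝ) :
    IntegrableOn f (Metric.closedBall 0 R) := by
  obtain ⟨φ, hφ⟩ := exists_schwartz_eqOn_one n R
  refine (hT.2 φ).1.integrableOn.congr_fun (fun x hx => ?_) measurableSet_closedBall
  simp only [hφ hx, Pi.one_apply, mul_one]

theorem IsFunction.tendsto_apply {ι : Type*} {l : Filter ι} {N : ℕ} (hT : IsFunction T f)
    {h : ι → 𝓢(Rn n, ℂ)} {g : Rn n → ℂ} (H : TendstoCompactContDiff N (fun i => h i) l g) :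
    Tendsto (fun i => T (h i)) l (𝓝 (∫ x, f x * g x)) := by
  obtain ⟨R, hhR, hgR⟩ := H.exists_closedBall
  set B : Set (Rn n) := Metric.closedBall 0 R
  have hf : IntegrableOn f B := hT.integrableOn_closedBall R
  have hint {φ : Rn n → ℂ} (hφ : Continuous φ) : IntegrableOn (fun x => f x * φ x) B :=
    hf.mul_continuousOn hφ.continuousOn (isCompact_closedBall 0 R)
  have hset {φ : Rn n → ℂ} (hφ : tsupport φ ⊆ B) :
      ∫ x in B, f x * φ x = ∫ x, f x * φ x :=
    setIntegral_eq_integral_of_forall_compl_eq_zero fun x hx => by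
      rw [image_eq_zero_of_notMem_tsupport fun hx' => hx (hφ hx'), mul_zero]
  set K := ∫ x in B, ‖f x‖
  have : 0 ≤ K := integral_nonneg fun x => norm_nonneg _
  refine Metric.tendsto_nhds.2 fun ε hε => ?_
  set δ := ε / (K + 1)
  have hδ : 0 < δ := by positivity
  filter_upwards [Metric.tendstoUniformly_iff.1 H.tendstoUniformly_coe δ hδ] with i hi
  calc dist (T (h i)) (∫ x, f x * g x) = ‖∫ x in B, (f x * h i x - f x * g x)‖ := by
        rw [dist_eq_norm, (hT.2 (h i)).2, ← hset (hhR i), ← hset hgR,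
          ← integral_sub (hint (h i).continuous) (hint H.contDiff_limit.continuous)]
    _ ≤ ∫ x in B, ‖f x‖ * δ := by
        refine norm_integral_le_of_norm_le (hf.norm.mul_const δ) (ae_of_all _ fun x => ?_)
        rw [← mul_sub, norm_mul, ← dist_eq_norm, dist_comm]
        gcongr
        exact (hi x).le
    _ = K * δ := integral_mul_const δ _
    _ < (K + 1) * δ := by linarith
    _ = ε := mul_div_cancel₀ _ (by positivity)

end IsFunction

section Inclusion

variable {n : ℕ} {p : ℝ≥0∞} [Fact (1 ≤ p)] {χ : Rn n → ℝ}

/-- The map `g ↦ F⁻¹ χ g` from the Schwartz space to `L_p`. -/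
def weightedFourierInv (hχ : Admissible p χ) :
    𝓢(Rn n, ℂ) →L[ℂ] Lp ℂ p (volume : Measure (Rn n)) :=
  scaledFourierLp hχ.hasPolyGrowth (finrank_lt_two_mul_plus n) (invConst n) neg_inv_two_pi_ne_zero

theorem isFunction_fourierD_schwartz (φ : 𝓢(Rn n, ℂ)) :
    IsFunction (fourierD n (SchwartzMap.toTemperedDistributionCLM (Rn n) ℂ volume φ))
      (fourierS n φ) := by
  refine ⟨(fourierS n φ).continuous.measurable, fun ψ =>
    ⟨integrable_mul_schwartz (fourierS n φ).integrable ψ, ?_⟩⟩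
  calc fourierD n (SchwartzMap.toTemperedDistributionCLM (Rn n) ℂ volume φ) ψ
      = ∫ x, φ x * fourierS n ψ x := by
        simp only [fourierD_apply, SchwartzMap.toTemperedDistributionCLM_apply_apply, smul_eq_mul,
          mul_comm (fourierS n ψ _)]
    _ = ∫ x, fourierS n φ x * ψ x := by rw [integral_mul_fourierS φ.integrable, coe_fourierS φ]

theorem isFunction_fourierD_weightedFourierInv (hχ : Admissible p χ) (g : 𝓢(Rn n, ℂ)) :
    IsFunction (fourierD n (Lp.toTemperedDistribution (weightedFourierInv hχ g)))
      (fun x => (χ x : ℂ) * g x) := by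
  have hint : Integrable fun x => (χ x : ℂ) * g x := hχ.hasPolyGrowth.integrable_smul_schwartz g
  refine ⟨(Complex.measurable_ofReal.comp hχ.memK.measurable).mul g.continuous.measurable, fun ψ =>
    ⟨integrable_mul_schwartz hint ψ, ?_⟩⟩
  rw [fourierD_apply, Lp.toTemperedDistribution_apply, ← integral_scaledFourier_mul_fourierS hint]
  refine integral_congr_ae ?_
  filter_upwards [coeFn_scaledFourierLp (q := p) hχ.hasPolyGrowth (finrank_lt_two_mul_plus n)
    (invConst n) neg_inv_two_pi_ne_zero g] with x hx
  rw [weightedFourierInv, hx, smul_eq_mul, mul_comm]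
  rfl

theorem isImage_schwartz (hχ : Admissible p χ) (φ : 𝓢(Rn n, ℂ)) :
    IsImage p χ (SchwartzMap.toTemperedDistributionCLM (Rn n) ℂ volume φ)
      (weightedFourierInv hχ (fourierS n φ)) := by
  have hT := isFunction_fourierD_schwartz φ
  have hS := isFunction_fourierD_weightedFourierInv hχ (fourierS n φ)
  refine ⟨_, ⟨fun _ => ⟨_, hT, hS⟩, fun _ ψ ψ' hψ => ?_⟩, fourierInvD_fourierD _⟩
  rw [(hS.2 ψ).2, (hT.2 ψ').2]
  simp only [hψ, mul_assoc, mul_left_comm (fourierS n φ _)]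

/-- The inclusion `𝓢 → H^χ_p`. -/
def schwartzInclusion (hχ : Admissible p χ) : 𝓢(Rn n, ℂ) →ₗ[ℂ] HSpace n p χ hχ :=
  LinearMap.codRestrict (HSubmodule n p χ)
    (SchwartzMap.toTemperedDistributionCLM (Rn n) ℂ volume).toLinearMap
    fun φ => ⟨_, isImage_schwartz hχ φ⟩

theorem toDistribution_schwartzInclusion (hχ : Admissible p χ) (φ : 𝓢(Rn n, ℂ)) :
    (schwartzInclusion hχ φ).toDistribution =
      SchwartzMap.toTemperedDistributionCLM (Rn n) ℂ volume φ := rfl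

theorem image_schwartzInclusion (hχ : Admissible p χ) (φ : 𝓢(Rn n, ℂ)) :
    HSpace.image (schwartzInclusion hχ φ) = weightedFourierInv hχ (fourierS n φ) :=
  (HSpace.isImage_image _).unique hχ (isImage_schwartz hχ φ)

theorem HSpace.isInducing_image {hχ : Admissible p χ} :
    IsInducing (HSpace.image : HSpace n p χ hχ → Lp ℂ p (volume : Measure (Rn n))) := ⟨rfl⟩

theorem continuous_schwartzInclusion (hχ : Admissible p χ) :
    Continuous (schwartzInclusion hχ) := by
  rw [HSpace.isInducing_image.continuous_iff]
  exact ((weightedFourierInv hχ).continuous.comp (fourierS n).continuous).congr fun φ =>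
    (image_schwartzInclusion hχ φ).symm

theorem injective_toTemperedDistributionCLM :
    Function.Injective (SchwartzMap.toTemperedDistributionCLM (Rn n) ℂ volume) := by
  intro f g hfg
  have : Fact ((1 : ℝ≥0∞) ≤ 1) := ⟨le_rfl⟩
  refine SchwartzMap.injective_toLp 1 volume
    (LinearMap.ker_eq_bot.1 (Lp.ker_toTemperedDistributionCLM_eq_bot (p := 1)) ?_)
  change Lp.toTemperedDistribution (f.toLp 1 volume) = Lp.toTemperedDistribution (g.toLp 1 volume)
  rw [Lp.toTemperedDistribution_toLp_eq, Lp.toTemperedDistribution_toLp_eq, hfg]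

theorem injective_schwartzInclusion (hχ : Admissible p χ) :
    Function.Injective (schwartzInclusion hχ) := fun _ _ h =>
  injective_toTemperedDistributionCLM (congrArg HSpace.toDistribution h)

end Inclusion

section Density

variable {n : ℕ} {p : ℝ≥0∞} [Fact (1 ≤ p)] {χ : Rn n → ℝ}

theorem toLp_fourierInvS_mem_closure (hχ : Admissible p χ) {ψ : 𝓢(Rn n, ℂ)}
    (hψ : HasCompactSupport ψ) :
    (fourierInvS n ψ).toLp p volume ∈ closure (Set.range (weightedFourierInv hχ)) := by
  obtain ⟨g, hg⟩ := hχ.exists_schwartz_tendsto_inv_smul hψ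
  refine mem_closure_of_tendsto (tendsto_scaledFourierLp hχ.hasPolyGrowth
    (finrank_lt_two_mul_plus n) (invConst n) neg_inv_two_pi_ne_zero hg ?_)
    (Eventually.of_forall fun j => Set.mem_range_self (g j))
  simp only [smul_inv_smul₀ (hχ.memK.pos _).ne', ← coe_fourierInvS]
  exact (fourierInvS n ψ).coeFn_toLp p volume

theorem denseRange_weightedFourierInv (hp : p < ⊤) (hχ : Admissible p χ) :
    DenseRange (weightedFourierInv hχ) := by
  let T : 𝓢(Rn n, ℂ) →L[ℂ] Lp ℂ p (volume : Measure (Rn n)) :=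
    SchwartzMap.toLpCLM ℂ ℂ p volume ∘L fourierInvS n
  have hT : DenseRange T := by
    refine (SchwartzMap.denseRange_toLpCLM (E := Rn n) (F := ℂ) (μ := volume) hp.ne).mono ?_
    rintro _ ⟨w, rfl⟩
    exact ⟨fourierS n w, by simp [T, fourierInvS_fourierS]⟩
  refine dense_closure.1 ((hT.dense_image T.continuous dense_hasCompactSupport).mono ?_)
  rintro _ ⟨ψ, hψ, rfl⟩
  exact toLp_fourierInvS_mem_closure hχ hψ

theorem denseRange_schwartzInclusion (hp : p < ⊤) (hχ : Admissible p χ) :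
    DenseRange (schwartzInclusion hχ) := by
  have hrange : HSpace.image '' Set.range (schwartzInclusion hχ) =
      Set.range (weightedFourierInv hχ) := by
    have hcomp : HSpace.image ∘ schwartzInclusion hχ = weightedFourierInv hχ ∘ fourierS n :=
      funext (image_schwartzInclusion hχ)
    rw [← Set.range_comp, hcomp]
    exact Function.Surjective.range_comp
      (fun ψ => ⟨fourierInvS n ψ, fourierS_fourierInvS ψ⟩) _
  intro u
  rw [HSpace.isInducing_image.closure_eq_preimage_closure_image, Set.mem_preimage, hrange]
  exact denseRange_weightedFourierInv hp hχ _

end Density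

section Distribution

variable {n : ℕ} {p : ℝ≥0∞} {χ : Rn n → ℝ} {q : ℝ≥0∞} [Fact (1 ≤ q)]

/-- The map `ψ ↦ F ψ` from the Schwartz space to `L_q`. -/
def fourierLp (n : ℕ) (q : ℝ≥0∞) [Fact (1 ≤ q)] :
    𝓢(Rn n, ℂ) →L[ℂ] Lp ℂ q (volume : Measure (Rn n)) :=
  scaledFourierLp (hasPolyGrowth_const (2 * plus n) (1 : ℝ)) (finrank_lt_two_mul_plus n) 1
    (inv_ne_zero two_pi_ne_zero)

/-- The map `ψ ↦ F χ⁻¹ ψ` from the Schwartz space to `L_q`. -/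
def invWeightedFourier (hχ : Admissible p χ) (q : ℝ≥0∞) [Fact (1 ≤ q)] :
    𝓢(Rn n, ℂ) →L[ℂ] Lp ℂ q (volume : Measure (Rn n)) :=
  scaledFourierLp hχ.hasPolyGrowth_inv (finrank_lt_two_mul_plus n) 1 (inv_ne_zero two_pi_ne_zero)

theorem coeFn_fourierLp (ψ : 𝓢(Rn n, ℂ)) :
    fourierLp n q ψ =ᵐ[volume] scaledFourier 1 (2 * Real.pi)⁻¹ ψ := by
  refine (coeFn_scaledFourierLp (q := q) _ _ _ _ ψ).trans ?_
  simp only [one_smul]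
  exact .rfl

theorem coeFn_invWeightedFourier (hχ : Admissible p χ) (ψ : 𝓢(Rn n, ℂ)) :
    invWeightedFourier hχ q ψ =ᵐ[volume]
      scaledFourier 1 (2 * Real.pi)⁻¹ fun x => (χ x)⁻¹ • ψ x :=
  coeFn_scaledFourierLp (q := q) _ _ _ _ ψ

theorem tendsto_fourierLp_invWeightedFourier {ι : Type*} {l : Filter ι} (hχ : Admissible p χ)
    {g : ι → 𝓢(Rn n, ℂ)} {ψ : 𝓢(Rn n, ℂ)}
    (hg : TendstoCompactContDiff (2 * plus n) (fun i => g i) l fun x => (χ x)⁻¹ • ψ x) :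
    Tendsto (fun i => fourierLp n q (g i)) l (𝓝 (invWeightedFourier hχ q ψ)) :=
  tendsto_scaledFourierLp _ _ _ _ hg
    (by simpa only [one_smul] using coeFn_invWeightedFourier hχ ψ)

variable [Fact (1 ≤ p)] [p.HolderConjugate q] {T S : 𝓢'(Rn n, ℂ)}
  {v : Lp ℂ p (volume : Measure (Rn n))}

/-- The pairing `(v, w) ↦ ∫ v w` of `L_p` and `L_q`. -/
def lpDual (n : ℕ) (p q : ℝ≥0∞) [Fact (1 ≤ p)] [Fact (1 ≤ q)] [p.HolderConjugate q] :
    Lp ℂ p (volume : Measure (Rn n)) →L[ℂ] Lp ℂ q (volume : Measure (Rn n)) →L[ℂ] ℂ :=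
  (ContinuousLinearMap.mul ℂ ℂ).lpPairing volume p q

theorem lpDual_apply (v : Lp ℂ p (volume : Measure (Rn n)))
    (w : Lp ℂ q (volume : Measure (Rn n))) : lpDual n p q v w = ∫ x, v x * w x :=
  ContinuousLinearMap.lpPairing_eq_integral _ _ _

theorem apply_eq_lpDual_of_fourierInvD_eq (hS : fourierInvD n S = Lp.toTemperedDistribution v)
    (ψ : 𝓢(Rn n, ℂ)) : S ψ = lpDual n p q v (fourierLp n q ψ) := calc
  S ψ = fourierInvD n S (fourierS n ψ) := by rw [fourierInvD_apply, fourierInvS_fourierS]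
  _ = ∫ x, fourierS n ψ x * v x := by simp only [hS, Lp.toTemperedDistribution_apply, smul_eq_mul]
  _ = lpDual n p q v (fourierLp n q ψ) := by
    rw [lpDual_apply]
    refine integral_congr_ae ?_
    filter_upwards [coeFn_fourierLp (q := q) ψ] with x hx
    rw [hx, coe_fourierS, mul_comm]

theorem IsFunctionProduct.apply_eq_lpDual (hTS : IsFunctionProduct χ T S) (hχ : Admissible p χ)
    (hS : fourierInvD n S = Lp.toTemperedDistribution v) {ψ : 𝓢(Rn n, ℂ)}
    (hψ : HasCompactSupport ψ) : T ψ = lpDual n p q v (invWeightedFourier hχ q ψ) := by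
  obtain ⟨f, hf, hχf⟩ := hTS
  obtain ⟨g, hg⟩ := hχ.exists_schwartz_tendsto_inv_smul hψ
  have hlim : Tendsto (fun j => S (g j)) atTop
      (𝓝 (lpDual n p q v (invWeightedFourier hχ q ψ))) := by
    simp only [apply_eq_lpDual_of_fourierInvD_eq (q := q) hS]
    exact ((lpDual n p q v).continuous.tendsto _).comp (tendsto_fourierLp_invWeightedFourier hχ hg)
  rw [tendsto_nhds_unique hlim (hχf.tendsto_apply hg), (hf.2 ψ).2]
  refine integral_congr_ae (ae_of_all _ fun x => ?_)
  have hχx : (χ x : ℂ) ≠ 0 := Complex.ofReal_ne_zero.2 (hχ.memK.pos x).ne'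
  simp only [Complex.real_smul, Complex.ofReal_inv]
  field_simp

theorem IsMultiplierProduct.apply_eq_lpDual (hTS : IsMultiplierProduct χ T S)
    (hχ : Admissible p χ) (hχs : ContDiff ℝ ∞ χ)
    (hS : fourierInvD n S = Lp.toTemperedDistribution v) {ψ : 𝓢(Rn n, ℂ)}
    (hψ : HasCompactSupport ψ) : T ψ = lpDual n p q v (invWeightedFourier hχ q ψ) := by
  have hne (x : Rn n) : χ x ≠ 0 := (hχ.memK.pos x).ne'
  let g : 𝓢(Rn n, ℂ) := (hψ.smul_left (f := fun x => (χ x)⁻¹)).toSchwartzMap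
    ((hχs.inv hne).smul (ψ.smooth _))
  have hψg (x : Rn n) : ψ x = (χ x : ℂ) * g x := by
    rw [← Complex.real_smul]
    exact (smul_inv_smul₀ (hne x) (ψ x)).symm
  have hg : fourierLp n q g = invWeightedFourier hχ q ψ :=
    Lp.ext ((coeFn_fourierLp g).trans (coeFn_invWeightedFourier hχ ψ).symm)
  rw [← hTS g ψ hψg, apply_eq_lpDual_of_fourierInvD_eq (q := q) hS, hg]

theorem IsImage.apply_eq_lpDual {u : 𝓢'(Rn n, ℂ)} (hu : IsImage p χ u v) (hχ : Admissible p χ)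
    (φ : 𝓢(Rn n, ℂ)) : u φ = lpDual n p q v (invWeightedFourier hχ q (fourierInvS n φ)) := by
  obtain ⟨S, hTS, hS⟩ := hu
  have hcompact : Set.EqOn (fourierD n u) (lpDual n p q v ∘ invWeightedFourier hχ q)
      {ψ | HasCompactSupport ψ} := fun ψ hψ => by
    rcases le_or_gt p 2 with hp | hp
    · exact (hTS.1 hp).apply_eq_lpDual hχ hS hψ
    · exact (hTS.2 hp).apply_eq_lpDual hχ (hχ.2 hp).contDiff hS hψ
  have heq : ⇑(fourierD n u) = lpDual n p q v ∘ invWeightedFourier hχ q :=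
    (fourierD n u).continuous.ext_on dense_hasCompactSupport
      ((lpDual n p q v).continuous.comp (invWeightedFourier hχ q).continuous) hcompact
  calc u φ = fourierD n u (fourierInvS n φ) := by rw [fourierD_apply, fourierS_fourierInvS]
    _ = lpDual n p q v (invWeightedFourier hχ q (fourierInvS n φ)) := congrFun heq _

theorem continuous_toDistribution (hχ : Admissible p χ) :
    Continuous (HSpace.toDistribution (hχ := hχ)) := by
  let q : ℝ≥0∞ := (1 - p⁻¹)⁻¹
  have hpq : p.HolderConjugate q := ENNReal.HolderConjugate.inv_one_sub_inv' Fact.out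
  have hq : Fact (1 ≤ q) := ⟨ENNReal.one_le_inv.2 tsub_le_self⟩
  refine PointwiseConvergenceCLM.continuous_of_continuous_eval fun φ => ?_
  have hcont : Continuous fun u : HSpace n p χ hχ =>
      (lpDual n p q).flip (invWeightedFourier hχ q (fourierInvS n φ)) (HSpace.image u) :=
    (ContinuousLinearMap.continuous _).comp HSpace.isInducing_image.continuous
  exact hcont.congr fun u => ((HSpace.isImage_image u).apply_eq_lpDual hχ φ).symm

end Distribution

end GenSobolev

end

theorem proposition2p5_general {n : ℕ} {p : ℝ≥0∞} [Fact (1 ≤ p)] (hp : p < ⊤)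
    (χ : GenSobolev.Rn n → ℝ) (hχ : GenSobolev.Admissible p χ) :
    (∃ ι : 𝓢(GenSobolev.Rn n, ℂ) →L[ℂ] GenSobolev.HSpace n p χ hχ,
      (∀ φ, (ι φ).toDistribution =
        SchwartzMap.toTemperedDistributionCLM (GenSobolev.Rn n) ℂ volume φ) ∧
      Function.Injective ι ∧ DenseRange ι) ∧
    Function.Injective (GenSobolev.HSpace.toDistribution (hχ := hχ)) ∧
    Continuous (GenSobolev.HSpace.toDistribution (hχ := hχ)) :=
  ⟨⟨⟨GenSobolev.schwartzInclusion hχ, GenSobolev.continuous_schwartzInclusion hχ⟩,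
    GenSobolev.toDistribution_schwartzInclusion hχ, GenSobolev.injective_schwartzInclusion hχ,
    GenSobolev.denseRange_schwartzInclusion hp hχ⟩, Subtype.val_injective,
    GenSobolev.continuous_toDistribution hχ⟩

/-- Both inclusions `𝓢 ⊂ H^χ_p ⊂ 𝓢'` hold, they are continuous, and `𝓢` is dense in `H^χ_p`. -/
theorem proposition2p5 {n : ℕ} {p : ℝ≥0∞} [Fact (1 ≤ p)] (hp₁ : 1 < p) (hp : p < ⊤)
    (χ : GenSobolev.Rn n → ℝ) (hχ : GenSobolev.Admissible p χ) :
    (∃ ι : 𝓢(GenSobolev.Rn n, ℂ) →L[ℂ] GenSobolev.HSpace n p χ hχ,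
      (∀ φ, (ι φ).toDistribution =
        SchwartzMap.toTemperedDistributionCLM (GenSobolev.Rn n) ℂ volume φ) ∧
      Function.Injective ι ∧ DenseRange ι) ∧
    Function.Injective (GenSobolev.HSpace.toDistribution (hχ := hχ)) ∧
    Continuous (GenSobolev.HSpace.toDistribution (hχ := hχ)) :=
  proposition2p5_general hp χ hχ
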